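/- Let $r,s\in\mathbb{C}^*$ be such that $r^m s^n=1$ with $m,n\in\mathbb{Z}$ implies $m=n=0$. Let $V=\check U^{\geq 0}_{r,s}(B_2)$ be the unital associative $\mathbb{C}$-algebra generated by $e_1,e_2,k_1^{\pm1},k_2^{\pm1}$ subject to the relations $$k_1k_1^{-1}=k_1^{-1}k_1=1=k_2k_2^{-1}=k_2^{-1}k_2,\qquad k_1k_2=k_2k_1,$$ $$k_1e_1=s^{-2}e_1k_1,\quad k_1e_2=rs\,e_2k_1,\quad k_2e_1=r^{-1}s^{-1}e_1k_2,\quad k_2e_2=r\,e_2k_2,$$ $$e_1^2e_2-(r^2+s^2)e_1e_2e_1+r^2s^2e_2e_1^2=0,$$ $$e_1e_2^3-(r^2+rs+s^2)e_2e_1e_2^2+rs(r^2+rs+s^2)e_2^2e_1e_2-r^3s^3e_2^3e_1=0.$$ Put $w_1=k_1^2k_2^{-2}$ and $w_2=k_1^{-1}k_2^2$. Equip $V$ with the Hopf algebra structure determined, for $l=1,2$, by $$\Delta(e_l)=e_l\otimes 1+w_l\otimes e_l,\quad \Delta(k_l)=k_l\otimes k_l,\quad \varepsilon(e_l)=0,\quad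 \varepsilon(k_l)=1,\quad S(e_l)=-w_l^{-1}e_l,\quad S(k_l)=k_l^{-1},$$ and let $\mathrm{Aut}_{\mathrm{Hopf}}(V)$ be the group of $\mathbb{C}$-algebra automorphisms of $V$ that commute with $\Delta$, $\varepsilon$ and $S$. Theorem. For every $\theta\in\mathrm{Aut}_{\mathrm{Hopf}}(V)$ there are $\gamma_1,\gamma_2\in\mathbb{C}^*$ such that, for $l=1,2$, $$\theta(k_l)=k_l,\qquad \theta(e_l)=\gamma_l e_l.$$ Moreover, $\theta\mapsto(\gamma_1,\gamma_2)$ is a (well-defined) isomorphism of groups; in particular $\mathrm{Aut}_{\mathrm{Hopf}}(V)\cong(\mathbb{C}^*)^2$. -/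

import Mathlib

open scoped TensorProduct

noncomputable section

namespace TwoParamB2

/-- The generators `e₁, e₂, k₁, k₁⁻¹, k₂, k₂⁻¹`. -/
inductive Gen : Type
  | e1 | e2 | k1 | k1inv | k2 | k2inv

open Gen in
/-- The defining relations of the augmented algebra `Ǔ^{≥0}_{r,s}(B₂)`. -/
inductive Rel (r s : ℂˣ) : FreeAlgebra ℂ Gen → FreeAlgebra ℂ Gen → Prop
  | k1_mul_inv : Rel r s (FreeAlgebra.ι ℂ k1 * FreeAlgebra.ι ℂ k1inv) 1
  | k1_inv_mul : Rel r s (FreeAlgebra.ι ℂ k1inv * FreeAlgebra.ι ℂ k1) 1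
  | k2_mul_inv : Rel r s (FreeAlgebra.ι ℂ k2 * FreeAlgebra.ι ℂ k2inv) 1
  | k2_inv_mul : Rel r s (FreeAlgebra.ι ℂ k2inv * FreeAlgebra.ι ℂ k2) 1
  | k1_k2 : Rel r s (FreeAlgebra.ι ℂ k1 * FreeAlgebra.ι ℂ k2)
      (FreeAlgebra.ι ℂ k2 * FreeAlgebra.ι ℂ k1)
  | k1_e1 : Rel r s (FreeAlgebra.ι ℂ k1 * FreeAlgebra.ι ℂ e1)
      (((s : ℂ) ^ 2)⁻¹ • (FreeAlgebra.ι ℂ e1 * FreeAlgebra.ι ℂ k1))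
  | k1_e2 : Rel r s (FreeAlgebra.ι ℂ k1 * FreeAlgebra.ι ℂ e2)
      (((r : ℂ) * s) • (FreeAlgebra.ι ℂ e2 * FreeAlgebra.ι ℂ k1))
  | k2_e1 : Rel r s (FreeAlgebra.ι ℂ k2 * FreeAlgebra.ι ℂ e1)
      (((r : ℂ)⁻¹ * (s : ℂ)⁻¹) • (FreeAlgebra.ι ℂ e1 * FreeAlgebra.ι ℂ k2))
  | k2_e2 : Rel r s (FreeAlgebra.ι ℂ k2 * FreeAlgebra.ι ℂ e2)
      ((r : ℂ) • (FreeAlgebra.ι ℂ e2 * FreeAlgebra.ι ℂ k2))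
  | serre1 : Rel r s
      (FreeAlgebra.ι ℂ e1 ^ 2 * FreeAlgebra.ι ℂ e2
        - ((r : ℂ) ^ 2 + (s : ℂ) ^ 2) •
            (FreeAlgebra.ι ℂ e1 * FreeAlgebra.ι ℂ e2 * FreeAlgebra.ι ℂ e1)
        + ((r : ℂ) ^ 2 * (s : ℂ) ^ 2) • (FreeAlgebra.ι ℂ e2 * FreeAlgebra.ι ℂ e1 ^ 2)) 0
  | serre2 : Rel r s
      (FreeAlgebra.ι ℂ e1 * FreeAlgebra.ι ℂ e2 ^ 3
        - ((r : ℂ) ^ 2 + r * s + (s : ℂ) ^ 2) •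
            (FreeAlgebra.ι ℂ e2 * FreeAlgebra.ι ℂ e1 * FreeAlgebra.ι ℂ e2 ^ 2)
        + ((r : ℂ) * s * ((r : ℂ) ^ 2 + r * s + (s : ℂ) ^ 2)) •
            (FreeAlgebra.ι ℂ e2 ^ 2 * FreeAlgebra.ι ℂ e1 * FreeAlgebra.ι ℂ e2)
        - ((r : ℂ) ^ 3 * (s : ℂ) ^ 3) • (FreeAlgebra.ι ℂ e2 ^ 3 * FreeAlgebra.ι ℂ e1)) 0

/-- The augmented two-parameter quantized algebra `Ǔ^{≥0}_{r,s}(B₂)`. -/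
def V (r s : ℂˣ) : Type := RingQuot (Rel r s)

instance (r s : ℂˣ) : Ring (V r s) := inferInstanceAs (Ring (RingQuot (Rel r s)))

instance (r s : ℂˣ) : Algebra ℂ (V r s) := inferInstanceAs (Algebra ℂ (RingQuot (Rel r s)))

/-- The quotient map from the free algebra. -/
def mk (r s : ℂˣ) : FreeAlgebra ℂ Gen →ₐ[ℂ] V r s := RingQuot.mkAlgHom ℂ (Rel r s)

/-- The image of a generator in `V r s`. -/
def gen (r s : ℂˣ) (x : Gen) : V r s := mk r s (FreeAlgebra.ι ℂ x)

/-- The generator `e₁`. -/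
def e1 (r s : ℂˣ) : V r s := gen r s .e1
/-- The generator `e₂`. -/
def e2 (r s : ℂˣ) : V r s := gen r s .e2
/-- The generator `k₁`. -/
def k1 (r s : ℂˣ) : V r s := gen r s .k1
/-- The generator `k₁⁻¹`. -/
def k1inv (r s : ℂˣ) : V r s := gen r s .k1inv
/-- The generator `k₂`. -/
def k2 (r s : ℂˣ) : V r s := gen r s .k2
/-- The generator `k₂⁻¹`. -/
def k2inv (r s : ℂˣ) : V r s := gen r s .k2inv

/-- `w₁ = k₁² k₂⁻²`. -/
def w1 (r s : ℂˣ) : V r s := k1 r s ^ 2 * k2inv r s ^ 2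
/-- `w₁⁻¹ = k₁⁻² k₂²`. -/
def w1inv (r s : ℂˣ) : V r s := k1inv r s ^ 2 * k2 r s ^ 2
/-- `w₂ = k₁⁻¹ k₂²`. -/
def w2 (r s : ℂˣ) : V r s := k1inv r s * k2 r s ^ 2
/-- `w₂⁻¹ = k₁ k₂⁻²`. -/
def w2inv (r s : ℂˣ) : V r s := k1 r s * k2inv r s ^ 2

/-- A family of elements `g` of a `ℂ`-algebra satisfies the defining relations. -/
structure Sat (r s : ℂˣ) {A : Type*} [Ring A] [Algebra ℂ A] (g : Gen → A) : Prop where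
  k1_mul_inv : g .k1 * g .k1inv = 1
  k1_inv_mul : g .k1inv * g .k1 = 1
  k2_mul_inv : g .k2 * g .k2inv = 1
  k2_inv_mul : g .k2inv * g .k2 = 1
  k1_k2 : g .k1 * g .k2 = g .k2 * g .k1
  k1_e1 : g .k1 * g .e1 = ((s : ℂ) ^ 2)⁻¹ • (g .e1 * g .k1)
  k1_e2 : g .k1 * g .e2 = ((r : ℂ) * s) • (g .e2 * g .k1)
  k2_e1 : g .k2 * g .e1 = ((r : ℂ)⁻¹ * (s : ℂ)⁻¹) • (g .e1 * g .k2)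
  k2_e2 : g .k2 * g .e2 = (r : ℂ) • (g .e2 * g .k2)
  serre1 : g .e1 ^ 2 * g .e2 - ((r : ℂ) ^ 2 + (s : ℂ) ^ 2) • (g .e1 * g .e2 * g .e1)
    + ((r : ℂ) ^ 2 * (s : ℂ) ^ 2) • (g .e2 * g .e1 ^ 2) = 0
  serre2 : g .e1 * g .e2 ^ 3
    - ((r : ℂ) ^ 2 + r * s + (s : ℂ) ^ 2) • (g .e2 * g .e1 * g .e2 ^ 2)
    + ((r : ℂ) * s * ((r : ℂ) ^ 2 + r * s + (s : ℂ) ^ 2)) • (g .e2 ^ 2 * g .e1 * g .e2)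
    - ((r : ℂ) ^ 3 * (s : ℂ) ^ 3) • (g .e2 ^ 3 * g .e1) = 0

theorem sat_gen (r s : ℂˣ) : Sat r s (gen r s) := by
  have key : ∀ {a b}, Rel r s a b →
      mk r s a = mk r s b :=
    fun h => RingQuot.mkAlgHom_rel ℂ h
  constructor
  · simpa only [gen, map_mul, map_one] using key (.k1_mul_inv (r := r) (s := s))
  · simpa only [gen, map_mul, map_one] using key (.k1_inv_mul (r := r) (s := s))
  · simpa only [gen, map_mul, map_one] using key (.k2_mul_inv (r := r) (s := s))
  · simpa only [gen, map_mul, map_one] using key (.k2_inv_mul (r := r) (s := s))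
  · simpa only [gen, map_mul] using key (.k1_k2 (r := r) (s := s))
  · simpa only [gen, map_mul, map_smul] using key (.k1_e1 (r := r) (s := s))
  · simpa only [gen, map_mul, map_smul] using key (.k1_e2 (r := r) (s := s))
  · simpa only [gen, map_mul, map_smul] using key (.k2_e1 (r := r) (s := s))
  · simpa only [gen, map_mul, map_smul] using key (.k2_e2 (r := r) (s := s))
  · simpa only [gen, map_mul, map_smul, map_add, map_sub, map_pow, map_zero]
      using key (.serre1 (r := r) (s := s))
  · simpa only [gen, map_mul, map_smul, map_add, map_sub, map_pow, map_zero]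
      using key (.serre2 (r := r) (s := s))

/-- The universal property: a family satisfying the relations extends to an algebra map. -/
def lift (r s : ℂˣ) {A : Type*} [Ring A] [Algebra ℂ A] (g : Gen → A) (h : Sat r s g) :
    V r s →ₐ[ℂ] A :=
  RingQuot.liftAlgHom ℂ ⟨FreeAlgebra.lift ℂ g, by
    intro x y hxy
    cases hxy
    · simpa using h.k1_mul_inv
    · simpa using h.k1_inv_mul
    · simpa using h.k2_mul_inv
    · simpa using h.k2_inv_mul
    · simpa using h.k1_k2
    · simpa using h.k1_e1
    · simpa using h.k1_e2
    · simpa using h.k2_e1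
    · simpa using h.k2_e2
    · simpa using h.serre1
    · simpa using h.serre2⟩

@[simp] theorem lift_gen (r s : ℂˣ) {A : Type*} [Ring A] [Algebra ℂ A] (g : Gen → A)
    (h : Sat r s g) (x : Gen) : lift r s g h (gen r s x) = g x := by
  unfold lift gen mk
  erw [RingQuot.liftAlgHom_mkAlgHom_apply]
  simp

theorem algHom_ext {r s : ℂˣ} {A : Type*} [Ring A] [Algebra ℂ A] {f f' : V r s →ₐ[ℂ] A}
    (h : ∀ x, f (gen r s x) = f' (gen r s x)) : f = f' := by
  refine RingQuot.ringQuot_ext' ℂ (s := Rel r s) f f' ?_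
  ext x
  exact h x

/-- Induction principle: a set containing scalars and generators and closed under sums and
products is everything. -/
theorem V.induction {r s : ℂˣ} {P : V r s → Prop} (hc : ∀ c : ℂ, P (algebraMap ℂ _ c))
    (hg : ∀ x, P (gen r s x)) (hadd : ∀ a b, P a → P b → P (a + b))
    (hmul : ∀ a b, P a → P b → P (a * b)) (a : V r s) : P a := by
  obtain ⟨a, rfl⟩ : ∃ b, mk r s b = a := RingQuot.mkAlgHom_surjective ℂ (Rel r s) a
  induction a using FreeAlgebra.induction with
  | grade0 c =>
    rw [AlgHom.commutes]
    exact hc c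
  | grade1 x => exact hg x
  | mul a b ha hb =>
    rw [map_mul]
    exact hmul _ _ ha hb
  | add a b ha hb =>
    rw [map_add]
    exact hadd _ _ ha hb

set_option linter.unusedSimpArgs false

section Aux

variable {A : Type*} [Ring A] [Algebra ℂ A] (r s : ℂˣ)

theorem serre1_add {a b c d : A}
    (hba : b * a = ((r : ℂ) ^ 2 * ((s : ℂ) ^ 2)⁻¹) • (a * b))
    (hbc : b * c = ((s : ℂ) ^ 2) • (c * b))
    (hda : d * a = ((r : ℂ) ^ 2)⁻¹ • (a * d))
    (hdc : d * c = ((r : ℂ) * (s : ℂ)⁻¹) • (c * d))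
    (h1 : a ^ 2 * c - ((r : ℂ) ^ 2 + (s : ℂ) ^ 2) • (a * c * a)
      + ((r : ℂ) ^ 2 * (s : ℂ) ^ 2) • (c * a ^ 2) = 0)
    (h2 : b ^ 2 * d - ((r : ℂ) ^ 2 + (s : ℂ) ^ 2) • (b * d * b)
      + ((r : ℂ) ^ 2 * (s : ℂ) ^ 2) • (d * b ^ 2) = 0) :
    (a + b) ^ 2 * (c + d) - ((r : ℂ) ^ 2 + (s : ℂ) ^ 2) • ((a + b) * (c + d) * (a + b))
      + ((r : ℂ) ^ 2 * (s : ℂ) ^ 2) • ((c + d) * (a + b) ^ 2) = 0 := by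
  have hr : (r : ℂ) ≠ 0 := r.ne_zero
  have hs : (s : ℂ) ≠ 0 := s.ne_zero
  have hba' : ∀ x, b * (a * x) = ((r : ℂ) ^ 2 * ((s : ℂ) ^ 2)⁻¹) • (a * (b * x)) := fun x => by
    rw [← mul_assoc, hba, smul_mul_assoc, mul_assoc]
  have hbc' : ∀ x, b * (c * x) = ((s : ℂ) ^ 2) • (c * (b * x)) := fun x => by
    rw [← mul_assoc, hbc, smul_mul_assoc, mul_assoc]
  have hda' : ∀ x, d * (a * x) = ((r : ℂ) ^ 2)⁻¹ • (a * (d * x)) := fun x => by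
    rw [← mul_assoc, hda, smul_mul_assoc, mul_assoc]
  have hdc' : ∀ x, d * (c * x) = ((r : ℂ) * (s : ℂ)⁻¹) • (c * (d * x)) := fun x => by
    rw [← mul_assoc, hdc, smul_mul_assoc, mul_assoc]
  have h3 := congrArg₂ (· + ·) h1 h2
  rw [← sub_eq_zero] at h3
  refine Eq.trans ?_ h3
  simp only [pow_succ, pow_zero, one_mul, mul_add, add_mul, mul_assoc, hba, hbc, hda, hdc,
    hba', hbc', hda', hdc', mul_smul_comm, smul_mul_assoc, smul_smul, smul_add, add_zero]
  match_scalars <;> field_simp <;> ring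

theorem serre2_add {a b c d : A}
    (hba : b * a = ((r : ℂ) ^ 2 * ((s : ℂ) ^ 2)⁻¹) • (a * b))
    (hbc : b * c = ((s : ℂ) ^ 2) • (c * b))
    (hda : d * a = ((r : ℂ) ^ 2)⁻¹ • (a * d))
    (hdc : d * c = ((r : ℂ) * (s : ℂ)⁻¹) • (c * d))
    (h1 : a * c ^ 3
      - ((r : ℂ) ^ 2 + r * s + (s : ℂ) ^ 2) • (c * a * c ^ 2)
      + ((r : ℂ) * s * ((r : ℂ) ^ 2 + r * s + (s : ℂ) ^ 2)) • (c ^ 2 * a * c)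
      - ((r : ℂ) ^ 3 * (s : ℂ) ^ 3) • (c ^ 3 * a) = 0)
    (h2 : b * d ^ 3
      - ((r : ℂ) ^ 2 + r * s + (s : ℂ) ^ 2) • (d * b * d ^ 2)
      + ((r : ℂ) * s * ((r : ℂ) ^ 2 + r * s + (s : ℂ) ^ 2)) • (d ^ 2 * b * d)
      - ((r : ℂ) ^ 3 * (s : ℂ) ^ 3) • (d ^ 3 * b) = 0) :
    (a + b) * (c + d) ^ 3
      - ((r : ℂ) ^ 2 + r * s + (s : ℂ) ^ 2) • ((c + d) * (a + b) * (c + d) ^ 2)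
      + ((r : ℂ) * s * ((r : ℂ) ^ 2 + r * s + (s : ℂ) ^ 2)) •
          ((c + d) ^ 2 * (a + b) * (c + d))
      - ((r : ℂ) ^ 3 * (s : ℂ) ^ 3) • ((c + d) ^ 3 * (a + b)) = 0 := by
  have hr : (r : ℂ) ≠ 0 := r.ne_zero
  have hs : (s : ℂ) ≠ 0 := s.ne_zero
  have hba' : ∀ x, b * (a * x) = ((r : ℂ) ^ 2 * ((s : ℂ) ^ 2)⁻¹) • (a * (b * x)) := fun x => by
    rw [← mul_assoc, hba, smul_mul_assoc, mul_assoc]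
  have hbc' : ∀ x, b * (c * x) = ((s : ℂ) ^ 2) • (c * (b * x)) := fun x => by
    rw [← mul_assoc, hbc, smul_mul_assoc, mul_assoc]
  have hda' : ∀ x, d * (a * x) = ((r : ℂ) ^ 2)⁻¹ • (a * (d * x)) := fun x => by
    rw [← mul_assoc, hda, smul_mul_assoc, mul_assoc]
  have hdc' : ∀ x, d * (c * x) = ((r : ℂ) * (s : ℂ)⁻¹) • (c * (d * x)) := fun x => by
    rw [← mul_assoc, hdc, smul_mul_assoc, mul_assoc]
  have h3 := congrArg₂ (· + ·) h1 h2
  rw [← sub_eq_zero] at h3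
  refine Eq.trans ?_ h3
  simp only [pow_succ, pow_zero, one_mul, mul_add, add_mul, mul_assoc, hba, hbc, hda, hdc,
    hba', hbc', hda', hdc', mul_smul_comm, smul_mul_assoc, smul_smul, smul_add, add_zero]
  match_scalars <;> field_simp <;> ring

end Aux

section Commutation

variable (r s : ℂˣ)

theorem inv_qcomm {A : Type*} [Ring A] [Algebra ℂ A] {k ki e : A} {q : ℂ} (hq : q ≠ 0)
    (h1 : k * ki = 1) (h2 : ki * k = 1) (h : k * e = q • (e * k)) :
    ki * e = q⁻¹ • (e * ki) := by
  have : q • (ki * e) = e * ki := by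
    calc q • (ki * e) = q • (ki * (e * (k * ki))) := by rw [h1, mul_one]
      _ = ki * (q • (e * k)) * ki := by simp only [mul_smul_comm, smul_mul_assoc, mul_assoc]
      _ = ki * k * e * ki := by rw [← h]; simp only [mul_assoc]
      _ = e * ki := by rw [h2, one_mul]
  rw [← this, smul_smul, inv_mul_cancel₀ hq, one_smul]

theorem inv_comm {A : Type*} [Ring A] {k ki e : A}
    (h1 : k * ki = 1) (h2 : ki * k = 1) (h : k * e = e * k) :
    ki * e = e * ki := by
  calc ki * e = ki * (e * (k * ki)) := by rw [h1, mul_one]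
    _ = ki * (e * k) * ki := by simp only [mul_assoc]
    _ = ki * k * e * ki := by rw [← h]; simp only [mul_assoc]
    _ = e * ki := by rw [h2, one_mul]

theorem assoc_smul {A : Type*} [Ring A] [Algebra ℂ A] {k e : A} {q : ℂ}
    (h : k * e = q • (e * k)) (x : A) : k * (e * x) = q • (e * (k * x)) := by
  rw [← mul_assoc, h, smul_mul_assoc, mul_assoc]

theorem assoc_comm {A : Type*} [Ring A] {k e : A}
    (h : k * e = e * k) (x : A) : k * (e * x) = e * (k * x) := by
  rw [← mul_assoc, h, mul_assoc]

theorem assoc_one {A : Type*} [Ring A] {k e : A}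
    (h : k * e = 1) (x : A) : k * (e * x) = x := by
  rw [← mul_assoc, h, one_mul]

theorem k1_mul_k1inv : k1 r s * k1inv r s = 1 := (sat_gen r s).k1_mul_inv
theorem k1inv_mul_k1 : k1inv r s * k1 r s = 1 := (sat_gen r s).k1_inv_mul
theorem k2_mul_k2inv : k2 r s * k2inv r s = 1 := (sat_gen r s).k2_mul_inv
theorem k2inv_mul_k2 : k2inv r s * k2 r s = 1 := (sat_gen r s).k2_inv_mul
theorem k1_mul_e1 : k1 r s * e1 r s = ((s : ℂ) ^ 2)⁻¹ • (e1 r s * k1 r s) := (sat_gen r s).k1_e1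
theorem k1inv_mul_e1 : k1inv r s * e1 r s = ((s : ℂ) ^ 2)⁻¹⁻¹ • (e1 r s * k1inv r s) :=
  inv_qcomm (by simp) (k1_mul_k1inv r s) (k1inv_mul_k1 r s) (k1_mul_e1 r s)
theorem k1_mul_e2 : k1 r s * e2 r s = ((r : ℂ) * s) • (e2 r s * k1 r s) := (sat_gen r s).k1_e2
theorem k1inv_mul_e2 : k1inv r s * e2 r s = ((r : ℂ) * s)⁻¹ • (e2 r s * k1inv r s) :=
  inv_qcomm (by simp) (k1_mul_k1inv r s) (k1inv_mul_k1 r s) (k1_mul_e2 r s)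
theorem k2_mul_e1 : k2 r s * e1 r s = ((r : ℂ)⁻¹ * (s : ℂ)⁻¹) • (e1 r s * k2 r s) := (sat_gen r s).k2_e1
theorem k2inv_mul_e1 : k2inv r s * e1 r s = ((r : ℂ)⁻¹ * (s : ℂ)⁻¹)⁻¹ • (e1 r s * k2inv r s) :=
  inv_qcomm (by simp) (k2_mul_k2inv r s) (k2inv_mul_k2 r s) (k2_mul_e1 r s)
theorem k2_mul_e2 : k2 r s * e2 r s = (r : ℂ) • (e2 r s * k2 r s) := (sat_gen r s).k2_e2
theorem k2inv_mul_e2 : k2inv r s * e2 r s = (r : ℂ)⁻¹ • (e2 r s * k2inv r s) :=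
  inv_qcomm (by simp) (k2_mul_k2inv r s) (k2inv_mul_k2 r s) (k2_mul_e2 r s)
theorem k2_mul_k1 : k2 r s * k1 r s = k1 r s * k2 r s := (sat_gen r s).k1_k2.symm
theorem k2_mul_k1inv : k2 r s * k1inv r s = k1inv r s * k2 r s :=
  (inv_comm (k1_mul_k1inv r s) (k1inv_mul_k1 r s) (k2_mul_k1 r s).symm).symm
theorem k2inv_mul_k1 : k2inv r s * k1 r s = k1 r s * k2inv r s :=
  inv_comm (k2_mul_k2inv r s) (k2inv_mul_k2 r s) (k2_mul_k1 r s)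
theorem k2inv_mul_k1inv : k2inv r s * k1inv r s = k1inv r s * k2inv r s :=
  inv_comm (k2_mul_k2inv r s) (k2inv_mul_k2 r s) (k2_mul_k1inv r s)

theorem k1_mul_k1inv_assoc (x : V r s) :
    k1 r s * (k1inv r s * x) = x :=
  assoc_one (k1_mul_k1inv r s) x
theorem k1inv_mul_k1_assoc (x : V r s) :
    k1inv r s * (k1 r s * x) = x :=
  assoc_one (k1inv_mul_k1 r s) x
theorem k2_mul_k2inv_assoc (x : V r s) :
    k2 r s * (k2inv r s * x) = x :=
  assoc_one (k2_mul_k2inv r s) x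
theorem k2inv_mul_k2_assoc (x : V r s) :
    k2inv r s * (k2 r s * x) = x :=
  assoc_one (k2inv_mul_k2 r s) x
theorem k1_mul_e1_assoc (x : V r s) :
    k1 r s * (e1 r s * x) = ((s : ℂ) ^ 2)⁻¹ • (e1 r s * (k1 r s * x)) :=
  assoc_smul (k1_mul_e1 r s) x
theorem k1inv_mul_e1_assoc (x : V r s) :
    k1inv r s * (e1 r s * x) = ((s : ℂ) ^ 2)⁻¹⁻¹ • (e1 r s * (k1inv r s * x)) :=
  assoc_smul (k1inv_mul_e1 r s) x
theorem k1_mul_e2_assoc (x : V r s) :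
    k1 r s * (e2 r s * x) = ((r : ℂ) * s) • (e2 r s * (k1 r s * x)) :=
  assoc_smul (k1_mul_e2 r s) x
theorem k1inv_mul_e2_assoc (x : V r s) :
    k1inv r s * (e2 r s * x) = ((r : ℂ) * s)⁻¹ • (e2 r s * (k1inv r s * x)) :=
  assoc_smul (k1inv_mul_e2 r s) x
theorem k2_mul_e1_assoc (x : V r s) :
    k2 r s * (e1 r s * x) = ((r : ℂ)⁻¹ * (s : ℂ)⁻¹) • (e1 r s * (k2 r s * x)) :=
  assoc_smul (k2_mul_e1 r s) x
theorem k2inv_mul_e1_assoc (x : V r s) :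
    k2inv r s * (e1 r s * x) = ((r : ℂ)⁻¹ * (s : ℂ)⁻¹)⁻¹ • (e1 r s * (k2inv r s * x)) :=
  assoc_smul (k2inv_mul_e1 r s) x
theorem k2_mul_e2_assoc (x : V r s) :
    k2 r s * (e2 r s * x) = (r : ℂ) • (e2 r s * (k2 r s * x)) :=
  assoc_smul (k2_mul_e2 r s) x
theorem k2inv_mul_e2_assoc (x : V r s) :
    k2inv r s * (e2 r s * x) = (r : ℂ)⁻¹ • (e2 r s * (k2inv r s * x)) :=
  assoc_smul (k2inv_mul_e2 r s) x
theorem k2_mul_k1_assoc (x : V r s) :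
    k2 r s * (k1 r s * x) = k1 r s * (k2 r s * x) :=
  assoc_comm (k2_mul_k1 r s) x
theorem k2_mul_k1inv_assoc (x : V r s) :
    k2 r s * (k1inv r s * x) = k1inv r s * (k2 r s * x) :=
  assoc_comm (k2_mul_k1inv r s) x
theorem k2inv_mul_k1_assoc (x : V r s) :
    k2inv r s * (k1 r s * x) = k1 r s * (k2inv r s * x) :=
  assoc_comm (k2inv_mul_k1 r s) x
theorem k2inv_mul_k1inv_assoc (x : V r s) :
    k2inv r s * (k1inv r s * x) = k1inv r s * (k2inv r s * x) :=
  assoc_comm (k2inv_mul_k1inv r s) x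

attribute [local simp] k1_mul_k1inv k1_mul_k1inv_assoc k1inv_mul_k1 k1inv_mul_k1_assoc k2_mul_k2inv
  k2_mul_k2inv_assoc k2inv_mul_k2 k2inv_mul_k2_assoc k1_mul_e1 k1_mul_e1_assoc k1inv_mul_e1
  k1inv_mul_e1_assoc k1_mul_e2 k1_mul_e2_assoc k1inv_mul_e2 k1inv_mul_e2_assoc k2_mul_e1
  k2_mul_e1_assoc k2inv_mul_e1 k2inv_mul_e1_assoc k2_mul_e2 k2_mul_e2_assoc k2inv_mul_e2
  k2inv_mul_e2_assoc k2_mul_k1 k2_mul_k1_assoc k2_mul_k1inv k2_mul_k1inv_assoc k2inv_mul_k1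
  k2inv_mul_k1_assoc k2inv_mul_k1inv k2inv_mul_k1inv_assoc

theorem w1_mul_e1 : w1 r s * e1 r s = ((r : ℂ) ^ 2 * ((s : ℂ) ^ 2)⁻¹) • (e1 r s * w1 r s) := by
  simp [w1, w2, w1inv, w2inv, pow_succ, mul_assoc, smul_smul]
  match_scalars
  field_simp

theorem w1_mul_e2 : w1 r s * e2 r s = ((s : ℂ) ^ 2) • (e2 r s * w1 r s) := by
  simp [w1, w2, w1inv, w2inv, pow_succ, mul_assoc, smul_smul]
  match_scalars
  field_simp

theorem w2_mul_e1 : w2 r s * e1 r s = ((r : ℂ) ^ 2)⁻¹ • (e1 r s * w2 r s) := by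
  simp [w1, w2, w1inv, w2inv, pow_succ, mul_assoc, smul_smul]
  match_scalars
  field_simp

theorem w2_mul_e2 : w2 r s * e2 r s = ((r : ℂ) * (s : ℂ)⁻¹) • (e2 r s * w2 r s) := by
  simp [w1, w2, w1inv, w2inv, pow_succ, mul_assoc, smul_smul]
  match_scalars
  field_simp

theorem w1_mul_w1inv : w1 r s * w1inv r s = 1 := by
  simp [w1, w2, w1inv, w2inv, pow_succ, mul_assoc, smul_smul]

theorem w1inv_mul_w1 : w1inv r s * w1 r s = 1 := by
  simp [w1, w2, w1inv, w2inv, pow_succ, mul_assoc, smul_smul]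

theorem w2_mul_w2inv : w2 r s * w2inv r s = 1 := by
  simp [w1, w2, w1inv, w2inv, pow_succ, mul_assoc, smul_smul]

theorem w2inv_mul_w2 : w2inv r s * w2 r s = 1 := by
  simp [w1, w2, w1inv, w2inv, pow_succ, mul_assoc, smul_smul]

theorem k1_mul_w1 : k1 r s * w1 r s = w1 r s * k1 r s := by
  simp [w1, w2, w1inv, w2inv, pow_succ, mul_assoc, smul_smul]

theorem k1_mul_w2 : k1 r s * w2 r s = w2 r s * k1 r s := by
  simp [w1, w2, w1inv, w2inv, pow_succ, mul_assoc, smul_smul]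

theorem k2_mul_w1 : k2 r s * w1 r s = w1 r s * k2 r s := by
  simp [w1, w2, w1inv, w2inv, pow_succ, mul_assoc, smul_smul]

theorem k2_mul_w2 : k2 r s * w2 r s = w2 r s * k2 r s := by
  simp [w1, w2, w1inv, w2inv, pow_succ, mul_assoc, smul_smul]

theorem w2_mul_w1 : w2 r s * w1 r s = w1 r s * w2 r s := by
  simp [w1, w2, w1inv, w2inv, pow_succ, mul_assoc, smul_smul]

/-- The values of the coproduct on generators. -/
def comulGen (r s : ℂˣ) : Gen → V r s ⊗[ℂ] V r s
  | .e1 => e1 r s ⊗ₜ 1 + w1 r s ⊗ₜ e1 r s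
  | .e2 => e2 r s ⊗ₜ 1 + w2 r s ⊗ₜ e2 r s
  | .k1 => k1 r s ⊗ₜ k1 r s
  | .k1inv => k1inv r s ⊗ₜ k1inv r s
  | .k2 => k2 r s ⊗ₜ k2 r s
  | .k2inv => k2inv r s ⊗ₜ k2inv r s

/-- The values of the counit on generators. -/
def counitGen : Gen → ℂ
  | .e1 => 0
  | .e2 => 0
  | .k1 => 1
  | .k1inv => 1
  | .k2 => 1
  | .k2inv => 1

/-- The values of the antipode on generators: `S(e_l) = -w_l⁻¹ e_l`, `S(k_l) = k_l⁻¹`. -/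
def antipodeGen (r s : ℂˣ) : Gen → (V r s)ᵐᵒᵖ
  | .e1 => MulOpposite.op (-(w1inv r s * e1 r s))
  | .e2 => MulOpposite.op (-(w2inv r s * e2 r s))
  | .k1 => MulOpposite.op (k1inv r s)
  | .k1inv => MulOpposite.op (k1 r s)
  | .k2 => MulOpposite.op (k2inv r s)
  | .k2inv => MulOpposite.op (k2 r s)

theorem serre1_V : e1 r s ^ 2 * e2 r s
    - ((r : ℂ) ^ 2 + (s : ℂ) ^ 2) • (e1 r s * e2 r s * e1 r s)
    + ((r : ℂ) ^ 2 * (s : ℂ) ^ 2) • (e2 r s * e1 r s ^ 2) = 0 := (sat_gen r s).serre1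

theorem serre2_V : e1 r s * e2 r s ^ 3
    - ((r : ℂ) ^ 2 + r * s + (s : ℂ) ^ 2) • (e2 r s * e1 r s * e2 r s ^ 2)
    + ((r : ℂ) * s * ((r : ℂ) ^ 2 + r * s + (s : ℂ) ^ 2)) •
        (e2 r s ^ 2 * e1 r s * e2 r s)
    - ((r : ℂ) ^ 3 * (s : ℂ) ^ 3) • (e2 r s ^ 3 * e1 r s) = 0 := (sat_gen r s).serre2

theorem w2_mul_w1_assoc (x : V r s) :
    w2 r s * (w1 r s * x) = w1 r s * (w2 r s * x) := assoc_comm (w2_mul_w1 r s) x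

theorem sat_comul : Sat r s (comulGen r s) where
  k1_mul_inv := by simp [comulGen, Algebra.TensorProduct.one_def]
  k1_inv_mul := by simp [comulGen, Algebra.TensorProduct.one_def]
  k2_mul_inv := by simp [comulGen, Algebra.TensorProduct.one_def]
  k2_inv_mul := by simp [comulGen, Algebra.TensorProduct.one_def]
  k1_k2 := by simp [comulGen]
  k1_e1 := by
    simp [comulGen, mul_add, add_mul, k1_mul_w1, TensorProduct.smul_tmul']
  k1_e2 := by
    simp [comulGen, mul_add, add_mul, k1_mul_w2, TensorProduct.smul_tmul']
  k2_e1 := by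
    simp [comulGen, mul_add, add_mul, k2_mul_w1, TensorProduct.smul_tmul']
  k2_e2 := by
    simp [comulGen, mul_add, add_mul, k2_mul_w2, TensorProduct.smul_tmul']
  serre1 := by
    refine serre1_add r s ?_ ?_ ?_ ?_ ?_ ?_
    · simp [w1_mul_e1, TensorProduct.smul_tmul']
    · simp [w1_mul_e2, TensorProduct.smul_tmul']
    · simp [w2_mul_e1, TensorProduct.smul_tmul']
    · simp [w2_mul_e2, TensorProduct.smul_tmul']
    · have h := congrArg (fun x : V r s => x ⊗ₜ[ℂ] (1 : V r s)) (serre1_V r s)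
      simpa [TensorProduct.add_tmul, TensorProduct.sub_tmul, TensorProduct.smul_tmul'] using h
    · have h := congrArg (fun x : V r s => (w1 r s ^ 2 * w2 r s) ⊗ₜ[ℂ] x) (serre1_V r s)
      simpa only [TensorProduct.tmul_add, TensorProduct.tmul_sub, TensorProduct.tmul_smul,
        TensorProduct.tmul_zero, Algebra.TensorProduct.tmul_mul_tmul, pow_succ, pow_zero, one_mul,
        mul_assoc, w2_mul_w1 r s, w2_mul_w1_assoc r s] using h
  serre2 := by
    refine serre2_add r s ?_ ?_ ?_ ?_ ?_ ?_
    · simp [w1_mul_e1, TensorProduct.smul_tmul']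
    · simp [w1_mul_e2, TensorProduct.smul_tmul']
    · simp [w2_mul_e1, TensorProduct.smul_tmul']
    · simp [w2_mul_e2, TensorProduct.smul_tmul']
    · have h := congrArg (fun x : V r s => x ⊗ₜ[ℂ] (1 : V r s)) (serre2_V r s)
      simpa [TensorProduct.add_tmul, TensorProduct.sub_tmul, TensorProduct.smul_tmul'] using h
    · have h := congrArg (fun x : V r s => (w1 r s * w2 r s ^ 3) ⊗ₜ[ℂ] x) (serre2_V r s)
      simpa only [TensorProduct.tmul_add, TensorProduct.tmul_sub, TensorProduct.tmul_smul,
        TensorProduct.tmul_zero, Algebra.TensorProduct.tmul_mul_tmul, pow_succ, pow_zero, one_mul,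
        mul_assoc, w2_mul_w1 r s, w2_mul_w1_assoc r s] using h

theorem sat_counit : Sat r s counitGen := by
  constructor
  all_goals simp [counitGen]

theorem sat_antipode : Sat r s (antipodeGen r s) where
  k1_mul_inv := by simp [antipodeGen, ← MulOpposite.op_mul]
  k1_inv_mul := by simp [antipodeGen, ← MulOpposite.op_mul]
  k2_mul_inv := by simp [antipodeGen, ← MulOpposite.op_mul]
  k2_inv_mul := by simp [antipodeGen, ← MulOpposite.op_mul]
  k1_k2 := by simp [antipodeGen, ← MulOpposite.op_mul]
  k1_e1 := by
    apply MulOpposite.unop_injective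
    simp [antipodeGen, w1inv, pow_succ, mul_assoc, smul_smul]
    match_scalars
    field_simp
  k1_e2 := by
    apply MulOpposite.unop_injective
    simp [antipodeGen, w2inv, pow_succ, mul_assoc, smul_smul]
    match_scalars
    field_simp
  k2_e1 := by
    apply MulOpposite.unop_injective
    simp [antipodeGen, w1inv, pow_succ, mul_assoc, smul_smul]
    match_scalars
    field_simp
  k2_e2 := by
    apply MulOpposite.unop_injective
    simp [antipodeGen, w2inv, pow_succ, mul_assoc, smul_smul]
    match_scalars
    field_simp
  serre1 := by
    apply MulOpposite.unop_injective
    have h := congrArg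
      (fun x : V r s => (-((s : ℂ) ^ 5 * ((r : ℂ) ^ 5)⁻¹)) • (x * (w1inv r s ^ 2 * w2inv r s)))
      (serre1_V r s)
    simp only [zero_mul, smul_zero] at h
    refine Eq.trans ?_ h
    simp [antipodeGen, w1inv, w2inv, pow_succ, mul_assoc, smul_smul, add_mul, sub_mul, smul_sub]
    match_scalars <;> field_simp
  serre2 := by
    apply MulOpposite.unop_injective
    have h := congrArg
      (fun x : V r s => (-((s : ℂ) ^ 5 * ((r : ℂ) ^ 5)⁻¹)) • (x * (w1inv r s * w2inv r s ^ 3)))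
      (serre2_V r s)
    simp only [zero_mul, smul_zero] at h
    refine Eq.trans ?_ h
    simp [antipodeGen, w1inv, w2inv, pow_succ, mul_assoc, smul_smul, add_mul, sub_mul, smul_sub]
    match_scalars <;> field_simp

end Commutation

/-- The coproduct `Δ(e_l) = e_l ⊗ 1 + w_l ⊗ e_l`, `Δ(k_l) = k_l ⊗ k_l`. -/
def comulHom (r s : ℂˣ) : V r s →ₐ[ℂ] V r s ⊗[ℂ] V r s := lift r s _ (sat_comul r s)

/-- The counit `ε(e_l) = 0`, `ε(k_l) = 1`. -/
def counitHom (r s : ℂˣ) : V r s →ₐ[ℂ] ℂ := lift r s _ (sat_counit r s)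

/-- The antipode, as an algebra map to the opposite algebra. -/
def antipodeHom (r s : ℂˣ) : V r s →ₐ[ℂ] (V r s)ᵐᵒᵖ := lift r s _ (sat_antipode r s)

instance (r s : ℂˣ) : Bialgebra ℂ (V r s) :=
  Bialgebra.ofAlgHom (comulHom r s) (counitHom r s)
    (by
      apply algHom_ext
      have h1 : comulHom r s (w1 r s) = w1 r s ⊗ₜ w1 r s := by
        simp [w1, k1, k2inv, comulHom, comulGen]
      have h2 : comulHom r s (w2 r s) = w2 r s ⊗ₜ w2 r s := by
        simp [w2, k1inv, k2, comulHom, comulGen]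
      have h (x) : comulHom r s (gen r s x) = comulGen r s x := lift_gen _ _ _ _ _
      rintro (_ | _ | _ | _ | _ | _) <;>
      simp [h, comulGen, h1, h2, e1, e2, k1, k2, k1inv, k2inv, TensorProduct.add_tmul,
        TensorProduct.tmul_add, Algebra.TensorProduct.one_def, add_assoc])
    (by
      apply algHom_ext
      have h1 : counitHom r s (w1 r s) = 1 := by
        simp [w1, k1, k2inv, counitHom, counitGen]
      have h2 : counitHom r s (w2 r s) = 1 := by
        simp [w2, k1inv, k2, counitHom, counitGen]
      have h (x) : comulHom r s (gen r s x) = comulGen r s x := lift_gen _ _ _ _ _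
      have h' (x) : counitHom r s (gen r s x) = counitGen x := lift_gen _ _ _ _ _
      rintro (_ | _ | _ | _ | _ | _) <;>
      simp [h, h', comulGen, counitGen, h1, h2, e1, e2, k1, k2, k1inv, k2inv])
    (by
      apply algHom_ext
      have h (x) : comulHom r s (gen r s x) = comulGen r s x := lift_gen _ _ _ _ _
      have h' (x) : counitHom r s (gen r s x) = counitGen x := lift_gen _ _ _ _ _
      rintro (_ | _ | _ | _ | _ | _) <;>
      simp [h, h', comulGen, counitGen, e1, e2, k1, k2, k1inv, k2inv])

theorem comul_eq (r s : ℂˣ) (a : V r s) : Coalgebra.comul (R := ℂ) a = comulHom r s a := rfl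

theorem counit_eq (r s : ℂˣ) (a : V r s) : Coalgebra.counit (R := ℂ) a = counitHom r s a := rfl

/-- The antipode, as a linear endomorphism. -/
def antipodeLin (r s : ℂˣ) : V r s →ₗ[ℂ] V r s :=
  (MulOpposite.opLinearEquiv ℂ).symm.toLinearMap ∘ₗ (antipodeHom r s).toLinearMap

theorem antipodeLin_mul (r s : ℂˣ) (a b : V r s) :
    antipodeLin r s (a * b) = antipodeLin r s b * antipodeLin r s a := by
  simp [antipodeLin]

theorem antipodeLin_algebraMap (r s : ℂˣ) (c : ℂ) :
    antipodeLin r s (algebraMap ℂ _ c) = algebraMap ℂ _ c := by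
  simp [antipodeLin]

theorem antipodeLin_gen (r s : ℂˣ) (x : Gen) :
    antipodeLin r s (gen r s x) = (antipodeGen r s x).unop := by
  simp [antipodeLin, antipodeHom]

theorem antipodeLin_w1 (r s : ℂˣ) : antipodeLin r s (w1 r s) = w1inv r s := by
  simp [w1, w1inv, pow_two, antipodeLin_mul, k1, k2inv, antipodeLin_gen, antipodeGen]
  simp only [← k1inv.eq_1, ← k2.eq_1, mul_assoc, k2_mul_k1inv, k2_mul_k1inv_assoc]

theorem antipodeLin_w2 (r s : ℂˣ) : antipodeLin r s (w2 r s) = w2inv r s := by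
  simp [w2, w2inv, pow_two, antipodeLin_mul, k1inv, k2, antipodeLin_gen, antipodeGen]
  simp only [← k1.eq_1, ← k2inv.eq_1, mul_assoc, k2inv_mul_k1, k2inv_mul_k1_assoc]

/-- Left convolution `a ⊗ b ↦ S(a) b`. -/
def convL (r s : ℂˣ) : V r s ⊗[ℂ] V r s →ₗ[ℂ] V r s :=
  LinearMap.mul' ℂ _ ∘ₗ (antipodeLin r s).rTensor _

/-- Right convolution `a ⊗ b ↦ a S(b)`. -/
def convR (r s : ℂˣ) : V r s ⊗[ℂ] V r s →ₗ[ℂ] V r s :=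
  LinearMap.mul' ℂ _ ∘ₗ (antipodeLin r s).lTensor _

theorem convL_tmul (r s : ℂˣ) (a b : V r s) :
    convL r s (a ⊗ₜ b) = antipodeLin r s a * b := by simp [convL]

theorem convR_tmul (r s : ℂˣ) (a b : V r s) :
    convR r s (a ⊗ₜ b) = a * antipodeLin r s b := by simp [convR]

theorem convL_mul (r s : ℂˣ) (t u : V r s ⊗[ℂ] V r s) (c : ℂ)
    (h : convL r s t = algebraMap ℂ _ c) : convL r s (t * u) = c • convL r s u := by
  induction u with
  | zero => simp
  | add u v hu hv => rw [mul_add, map_add, hu, hv, map_add, smul_add]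
  | tmul x y =>
    have key : convL r s (t * x ⊗ₜ y) = antipodeLin r s x * convL r s t * y := by
      clear h
      induction t with
      | zero => simp
      | add t v ht hv => rw [add_mul, map_add, ht, hv, map_add, mul_add, add_mul]
      | tmul a b => simp [convL_tmul, antipodeLin_mul, mul_assoc]
    rw [key, h, convL_tmul, ← Algebra.commutes, mul_assoc, Algebra.smul_def]

theorem convR_mul (r s : ℂˣ) (t u : V r s ⊗[ℂ] V r s) (c : ℂ)
    (h : convR r s u = algebraMap ℂ _ c) : convR r s (t * u) = c • convR r s t := by
  induction t with
  | zero => simp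
  | add u v hu hv => rw [add_mul, map_add, hu, hv, map_add, smul_add]
  | tmul x y =>
    have key : convR r s (x ⊗ₜ y * u) = x * convR r s u * antipodeLin r s y := by
      clear h
      induction u with
      | zero => simp
      | add t v ht hv => rw [mul_add, map_add, ht, hv, map_add, mul_add, add_mul]
      | tmul a b => simp [convR_tmul, antipodeLin_mul, mul_assoc]
    rw [key, h, convR_tmul, ← Algebra.commutes, mul_assoc, Algebra.smul_def]

theorem convL_comul (r s : ℂˣ) (a : V r s) :
    convL r s (comulHom r s a) = algebraMap ℂ _ (counitHom r s a) := by
  induction a using V.induction with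
  | hc c =>
    rw [AlgHom.commutes, AlgHom.commutes, Algebra.TensorProduct.algebraMap_apply, convL_tmul,
      antipodeLin_algebraMap, mul_one]
    rfl
  | hadd a b ha hb => simp [map_add, ha, hb]
  | hmul a b ha hb =>
    rw [map_mul, convL_mul r s _ _ _ ha, hb, map_mul, map_mul, Algebra.smul_def]
  | hg x =>
    have h : comulHom r s (gen r s x) = comulGen r s x := lift_gen _ _ _ _ _
    have h' : counitHom r s (gen r s x) = counitGen x := lift_gen _ _ _ _ _
    rw [h, h']
    have hg := antipodeLin_gen r s x
    cases x
    · simp [comulGen, counitGen, convL_tmul, antipodeLin_w1, e1, hg, antipodeGen]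
    · simp [comulGen, counitGen, convL_tmul, antipodeLin_w2, e2, hg, antipodeGen]
    · rw [show comulGen r s .k1 = gen r s .k1 ⊗ₜ gen r s .k1 from rfl, convL_tmul, hg]
      simpa [antipodeGen, counitGen, k1, k1inv, k2, k2inv] using k1inv_mul_k1 r s
    · rw [show comulGen r s .k1inv = gen r s .k1inv ⊗ₜ gen r s .k1inv from rfl, convL_tmul, hg]
      simpa [antipodeGen, counitGen, k1, k1inv, k2, k2inv] using k1_mul_k1inv r s
    · rw [show comulGen r s .k2 = gen r s .k2 ⊗ₜ gen r s .k2 from rfl, convL_tmul, hg]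
      simpa [antipodeGen, counitGen, k1, k1inv, k2, k2inv] using k2inv_mul_k2 r s
    · rw [show comulGen r s .k2inv = gen r s .k2inv ⊗ₜ gen r s .k2inv from rfl, convL_tmul, hg]
      simpa [antipodeGen, counitGen, k1, k1inv, k2, k2inv] using k2_mul_k2inv r s

theorem convR_comul (r s : ℂˣ) (a : V r s) :
    convR r s (comulHom r s a) = algebraMap ℂ _ (counitHom r s a) := by
  induction a using V.induction with
  | hc c =>
    rw [AlgHom.commutes, AlgHom.commutes, Algebra.TensorProduct.algebraMap_apply, convR_tmul,
      ← map_one (algebraMap ℂ (V r s)), antipodeLin_algebraMap, map_one, mul_one]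
    rfl
  | hadd a b ha hb => simp [map_add, ha, hb]
  | hmul a b ha hb =>
    rw [map_mul, convR_mul r s _ _ _ hb, ha, map_mul, mul_comm, map_mul, Algebra.smul_def]
  | hg x =>
    have h : comulHom r s (gen r s x) = comulGen r s x := lift_gen _ _ _ _ _
    have h' : counitHom r s (gen r s x) = counitGen x := lift_gen _ _ _ _ _
    rw [h, h']
    have hg := antipodeLin_gen r s x
    have h1 : antipodeLin r s (1 : V r s) = 1 := by
      simpa using antipodeLin_algebraMap r s 1
    cases x
    · simp [comulGen, counitGen, convR_tmul, h1, e1, hg, antipodeGen, ← mul_assoc,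
        w1_mul_w1inv]
    · simp [comulGen, counitGen, convR_tmul, h1, e2, hg, antipodeGen, ← mul_assoc,
        w2_mul_w2inv]
    · rw [show comulGen r s .k1 = gen r s .k1 ⊗ₜ gen r s .k1 from rfl, convR_tmul, hg]
      simpa [antipodeGen, counitGen, k1, k1inv, k2, k2inv] using k1_mul_k1inv r s
    · rw [show comulGen r s .k1inv = gen r s .k1inv ⊗ₜ gen r s .k1inv from rfl, convR_tmul, hg]
      simpa [antipodeGen, counitGen, k1, k1inv, k2, k2inv] using k1inv_mul_k1 r s
    · rw [show comulGen r s .k2 = gen r s .k2 ⊗ₜ gen r s .k2 from rfl, convR_tmul, hg]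
      simpa [antipodeGen, counitGen, k1, k1inv, k2, k2inv] using k2_mul_k2inv r s
    · rw [show comulGen r s .k2inv = gen r s .k2inv ⊗ₜ gen r s .k2inv from rfl, convR_tmul, hg]
      simpa [antipodeGen, counitGen, k1, k1inv, k2, k2inv] using k2inv_mul_k2 r s

instance (r s : ℂˣ) : HopfAlgebra ℂ (V r s) where
  antipode := antipodeLin r s
  mul_antipode_rTensor_comul := LinearMap.ext (convL_comul r s)
  mul_antipode_lTensor_comul := LinearMap.ext (convR_comul r s)

/-- The group of Hopf algebra automorphisms of a Hopf algebra `H`: the algebra automorphisms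
compatible with coproduct, counit and antipode. -/
def HopfAut (R H : Type*) [CommRing R] [Ring H] [HopfAlgebra R H] : Subgroup (H ≃ₐ[R] H) where
  carrier := {θ | (∀ a, Coalgebra.comul (R := R) (θ a) =
        TensorProduct.map θ.toLinearMap θ.toLinearMap (Coalgebra.comul (R := R) a)) ∧
      (∀ a, Coalgebra.counit (R := R) (θ a) = Coalgebra.counit (R := R) a) ∧
      (∀ a, HopfAlgebra.antipode R (θ a) = θ (HopfAlgebra.antipode R a))}
  one_mem' := by
    refine ⟨fun a => ?_, fun a => rfl, fun a => rfl⟩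
    exact (LinearMap.congr_fun TensorProduct.map_id _).symm
  mul_mem' := by
    rintro f g ⟨hf1, hf2, hf3⟩ ⟨hg1, hg2, hg3⟩
    refine ⟨fun a => ?_, fun a => ?_, fun a => ?_⟩
    · rw [AlgEquiv.mul_apply, hf1, hg1]
      exact (LinearMap.congr_fun (TensorProduct.map_comp _ _ _ _) _).symm
    · rw [AlgEquiv.mul_apply, hf2, hg2]
    · rw [AlgEquiv.mul_apply, hf3, hg3, AlgEquiv.mul_apply]
  inv_mem' := by
    rintro f ⟨hf1, hf2, hf3⟩
    have hinv : ∀ b, f⁻¹ (f b) = b := f.symm_apply_apply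
    refine ⟨fun a => ?_, fun a => ?_, fun a => ?_⟩
    · obtain ⟨b, rfl⟩ := f.surjective a
      have hc : (f⁻¹).toLinearMap ∘ₗ f.toLinearMap = LinearMap.id := LinearMap.ext hinv
      rw [hinv, hf1, ← LinearMap.comp_apply, ← TensorProduct.map_comp, hc, TensorProduct.map_id,
        LinearMap.id_apply]
    · obtain ⟨b, rfl⟩ := f.surjective a
      rw [hf2, hinv]
    · obtain ⟨b, rfl⟩ := f.surjective a
      rw [hf3, hinv, hinv]

end TwoParamB2

end

namespace TwoParamB2

/-! ### Eigenvectors, group-like elements and skew-primitive elements in general -/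

section General

/-! Everything is read off from conjugation by `k₁`. The algebra is spanned by words in `e₁, e₂`
followed by `k₁ᵃ k₂ᵇ`, and such a monomial with `i` letters `e₁` and `j` letters `e₂` is an
eigenvector with eigenvalue `r ^ j * s ^ (j - 2 i)`. Since `r` and `s` are multiplicatively
independent, the eigenvalue, and even any positive power of it, determines the weight `(i, j)`. No
PBW basis is needed: spanning, `e_l ≠ 0` and the linear independence of group-like elements suffice.

Group-like elements (`eq_torus_of_isGroupLikeElem`): conjugation by `k₁` permutes them and keeps
each one in a finite-dimensional space, so by independence its orbits are finite. A group-like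
element thus has weight zero, is a combination of the `k₁ᵃ k₂ᵇ`, and by independence again is one of
them.

Let `θ` be a Hopf automorphism. As `θ⁻¹(k₁)` is some `k₁ᵃ k₂ᵇ`, each `θ(e_l)` has a weight `μ_l`
(`exists_weight`). Surjectivity makes every weight that occurs a combination of `μ₁, μ₂` over `ℕ`
(`weight_eq_of_surjective`), so these are `(1, 0)` and `(0, 1)` in some order. Then `θ(e_l)` is a
generator `e_m` times a combination of group-like elements, and skew-primitivity reduces it to a
multiple of `e_m` and forces `θ(w_l) = w_m` (`skewPrimitive_eq_smul`). In either order `k₁ = w₁ w₂`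
is fixed, so `θ` preserves weights and the swap is impossible. Finally `k₂² = k₁ w₂` is fixed, hence
so is `k₂`. Conversely all rescalings of `e₁, e₂` are Hopf automorphisms. -/

/-- Eigenspaces are independent: splitting `v` into its `c`-part and a part in the other
eigenspaces, the second part is also a `c`-eigenvector and so vanishes. The set `X` may be linearly
dependent, which is why a mere spanning set of monomials is enough. -/
theorem mem_span_inter_eigenspace {K M : Type*} [Field K] [AddCommGroup M] [Module K M]
    (f : Module.End K M) {X : Set M} (hX : ∀ x ∈ X, ∃ c : K, f x = c • x) {v : M} {c : K}
    (hv : v ∈ Submodule.span K X) (hc : f v = c • v) :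
    v ∈ Submodule.span K {x ∈ X | f x = c • x} := by
  have hle : Submodule.span K X ≤ Submodule.span K {x ∈ X | f x = c • x} ⊔
      ⨆ d, ⨆ _ : d ≠ c, f.eigenspace d := by
    rw [Submodule.span_le]
    intro x hx
    obtain ⟨d, hd⟩ := hX x hx
    by_cases hdc : d = c
    · exact Submodule.mem_sup_left (Submodule.subset_span ⟨hx, hdc ▸ hd⟩)
    · exact Submodule.mem_sup_right
        (Submodule.mem_iSup_of_mem d (Submodule.mem_iSup_of_mem hdc
          (Module.End.mem_eigenspace_iff.mpr hd)))
  obtain ⟨y, hy, z, hz, rfl⟩ := Submodule.mem_sup.mp (hle hv)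
  have hyc : y ∈ f.eigenspace c := by
    refine Submodule.span_le.mpr ?_ hy
    rintro x ⟨-, hx⟩
    exact Module.End.mem_eigenspace_iff.mpr hx
  have hzc : z ∈ f.eigenspace c := by
    simpa using sub_mem (Module.End.mem_eigenspace_iff.mpr hc) hyc
  have hz0 : z = 0 :=
    Submodule.disjoint_def.mp (f.eigenspaces_iSupIndep c) z hzc hz
  simpa [hz0] using hy

/-- Identifies an eigenvalue met on an arbitrary vector as the eigenvalue of a nonzero spanning
vector, hence later as the character of a weight. -/
theorem exists_mem_eigenvector {K M : Type*} [Field K] [AddCommGroup M] [Module K M]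
    (f : Module.End K M) {X : Set M} (hX : ∀ x ∈ X, ∃ c : K, f x = c • x) {v : M} {c : K}
    (hv : v ∈ Submodule.span K X) (hc : f v = c • v) (hv0 : v ≠ 0) :
    ∃ x ∈ X, f x = c • x ∧ x ≠ 0 := by
  by_contra! h
  refine hv0 ((Submodule.mem_bot K).mp (Submodule.span_le.mpr ?_
    (mem_span_inter_eigenspace f hX hv hc)))
  rintro x ⟨hx, hx'⟩
  exact h x hx hx'

/-- A group-like element lying in the span of eigenvectors of an injective linear map which
preserves group-like elements has a finite orbit. -/
theorem exists_iterate_eq_of_isGroupLikeElem {K C : Type*} [Field K] [AddCommGroup C] [Module K C]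
    [Coalgebra K C] (f : Module.End K C) (hf : Function.Injective f)
    (hfg : ∀ g, IsGroupLikeElem K g → IsGroupLikeElem K (f g))
    {X : Set C} (hX : ∀ x ∈ X, ∃ c : K, f x = c • x) {g : C} (hg : IsGroupLikeElem K g)
    (hv : g ∈ Submodule.span K X) : ∃ n : ℕ, 0 < n ∧ (f ^ n) g = g := by
  -- Finitely many eigenvectors span an `f`-stable, finite-dimensional subspace, which contains the
  -- whole orbit of `g`.
  obtain ⟨t, htX, hgt⟩ := Submodule.mem_span_finite_of_mem_span hv
  have hstable : Submodule.span K (t : Set C) ≤ (Submodule.span K (t : Set C)).comap f := by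
    rw [Submodule.span_le]
    intro x hx
    obtain ⟨c, hc⟩ := hX x (htX hx)
    simpa [hc] using Submodule.smul_mem _ c (Submodule.subset_span hx)
  have hmem : ∀ n : ℕ, (f ^ n) g ∈ Submodule.span K (t : Set C) := by
    intro n
    induction n with
    | zero => simpa using hgt
    | succ n ih =>
      rw [pow_succ', Module.End.mul_apply]
      exact hstable ih
  have hgl : ∀ n : ℕ, IsGroupLikeElem K ((f ^ n) g) := by
    intro n
    induction n with
    | zero => simpa using hg
    | succ n ih =>
      rw [pow_succ', Module.End.mul_apply]
      exact hfg _ ih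
  -- Distinct group-like elements are linearly independent, so an infinite orbit cannot fit in that
  -- subspace.
  have hninj : ¬ Function.Injective fun n : ℕ => (f ^ n) g := by
    intro hinj
    have hli : LinearIndependent K fun n : ℕ => (f ^ n) g :=
      linearIndep_groupLikeVal.comp (fun n => (⟨_, hgl n⟩ : GroupLike K C))
        fun m n h => hinj (congrArg GroupLike.val h)
    have hli' : LinearIndependent K
        fun n : ℕ => (⟨(f ^ n) g, hmem n⟩ : Submodule.span K (t : Set C)) :=
      LinearIndependent.of_comp (Submodule.subtype _) hli
    have : Finite ℕ := hli'.finite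
    exact not_finite ℕ
  simp only [Function.Injective, not_forall] at hninj
  obtain ⟨m, n, h, hne⟩ := hninj
  wlog hlt : m < n generalizing m n
  · exact this n m h.symm (Ne.symm hne) (by omega)
  refine ⟨n - m, by omega, ?_⟩
  -- Injectivity cancels `f ^ m`, turning the repetition at times `m` and `n` into a return to `g`
  -- itself.
  have hm : Function.Injective (f ^ m) := by
    rw [Module.End.coe_pow]
    exact hf.iterate m
  apply hm
  rw [← Module.End.mul_apply, ← pow_add, Nat.add_sub_cancel' hlt.le]
  exact h.symm

/-- Group-like elements are linearly independent, so they extend to a basis; `φ` is the coordinate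
at `a`. -/
theorem exists_dual_groupLike {K C : Type*} [Field K] [AddCommGroup C] [Module K C]
    [Coalgebra K C] {a : C} (ha : IsGroupLikeElem K a) :
    ∃ φ : C →ₗ[K] K, φ a = 1 ∧ ∀ b, IsGroupLikeElem K b → b ≠ a → φ b = 0 := by
  classical
  have hli := linearIndepOn_isGroupLikeElem (R := K) (A := C)
  let B := Module.Basis.extend hli
  have hB : ∀ b (hb : IsGroupLikeElem K b), B ⟨b, hli.subset_extend _ hb⟩ = b := fun b hb => by
    simp [B]
  have hcoord : ∀ b (hb : IsGroupLikeElem K b), B.coord ⟨a, hli.subset_extend _ ha⟩ b =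
      B.coord ⟨a, hli.subset_extend _ ha⟩ (B ⟨b, hli.subset_extend _ hb⟩) := fun b hb => by
    rw [hB b hb]
  refine ⟨B.coord ⟨a, hli.subset_extend _ ha⟩, ?_, fun b hb hba => ?_⟩
  · rw [hcoord a ha]
    simp
  · rw [hcoord b hb, Module.Basis.coord_apply, Module.Basis.repr_self, Finsupp.single_eq_of_ne]
    simpa using Ne.symm hba

/-- Skew-primitive elements of the form `e * p`, with `e` skew-primitive and `p` a combination of
group-like elements, are multiples of `e`. -/
theorem skewPrimitive_eq_smul {K H : Type*} [Field K] [Ring H] [HopfAlgebra K H] {P : H →ₐ[K] H}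
    (hP : ∀ g, IsGroupLikeElem K g → P g = g) {e w h p : H} (hPe : P e = 0)
    (he : Coalgebra.comul (R := K) e = e ⊗ₜ[K] 1 + w ⊗ₜ[K] e)
    (hw : IsGroupLikeElem K w) (hh : IsGroupLikeElem K h)
    (hp : p ∈ Submodule.span K {g : H | IsGroupLikeElem K g}) (h0 : e * p ≠ 0)
    (hcomul : Coalgebra.comul (R := K) (e * p) = (e * p) ⊗ₜ[K] 1 + h ⊗ₜ[K] (e * p)) :
    h = w ∧ ∃ c : K, c ≠ 0 ∧ e * p = c • e := by
  classical
  obtain ⟨u, rfl⟩ := hw.isUnit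
  obtain ⟨c, hc, rfl⟩ := Submodule.mem_span_set.mp hp
  have hgl : ∀ g ∈ c.support, IsGroupLikeElem K g := fun g hg => hc hg
  have hcop : Coalgebra.comul (R := K) (e * c.sum fun g a => a • g) =
      c.sum fun g a => a • ((e * g) ⊗ₜ[K] g + (↑u * g) ⊗ₜ[K] (e * g)) := by
    rw [Bialgebra.comul_mul, he, Finsupp.sum, map_sum, Finset.mul_sum, Finsupp.sum]
    refine Finset.sum_congr rfl fun g hg => ?_
    rw [map_smul, (hgl g hg).comul_eq_tmul_self, mul_smul_comm, add_mul]
    simp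
  have hc0 : c ≠ 0 := by
    rintro rfl
    simp at h0
  obtain ⟨g₀, hg₀⟩ := Finsupp.support_nonempty_iff.mpr hc0
  -- Apply `φ ∘ P` to the left tensor factor of both expressions for the coproduct. `P` kills the
  -- terms whose left factor contains `e`, and `φ`, dual to `w * g₀`, isolates the single summand
  -- `g₀`.
  obtain ⟨φ, hφ1, hφ0⟩ := exists_dual_groupLike (hw.mul (hgl g₀ hg₀))
  have key := congrArg (fun t => TensorProduct.lid K H (TensorProduct.map (φ ∘ₗ P.toLinearMap)
    LinearMap.id t)) (hcomul.symm.trans hcop)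
  have hright : (TensorProduct.lid K H (TensorProduct.map (φ ∘ₗ P.toLinearMap) LinearMap.id
      (c.sum fun g a => a • ((e * g) ⊗ₜ[K] g + (↑u * g) ⊗ₜ[K] (e * g))))) = c g₀ • (e * g₀) := by
    rw [Finsupp.sum, map_sum, map_sum, Finset.sum_eq_single g₀]
    · simp [hPe, hP _ hw, hP _ (hgl g₀ hg₀), hφ1]
    · intro g hg hne
      have : φ (↑u * g) = 0 := hφ0 _ (hw.mul (hgl g hg)) (by simpa using hne)
      simp [hPe, hP _ hw, hP _ (hgl g hg), this]
    · exact fun h => absurd hg₀ h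
  have hleft : (TensorProduct.lid K H (TensorProduct.map (φ ∘ₗ P.toLinearMap) LinearMap.id
      ((e * c.sum fun g a => a • g) ⊗ₜ[K] 1 + h ⊗ₜ[K] (e * c.sum fun g a => a • g)))) =
      φ h • (e * c.sum fun g a => a • g) := by
    simp [hPe, hP _ hh]
  have key' : φ h • (e * c.sum fun g a => a • g) = c g₀ • (e * g₀) := by
    rw [← hleft, ← hright]; exact key
  have he0 : e ≠ 0 := by
    rintro rfl
    simp at h0
  obtain ⟨v, hv⟩ := (hgl g₀ hg₀).isUnit
  have heg : e * g₀ ≠ 0 := by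
    rw [← hv]
    simpa using he0
  have hcg : c g₀ ≠ 0 := Finsupp.mem_support_iff.mp hg₀
  -- The right side of `key'` is nonzero, so `φ h` is nonzero. This identifies `h`, and then shows
  -- that `g₀` is the only group-like element contributing to `e * p`.
  have hhg : h = ↑u * g₀ := by
    by_contra hne
    rw [hφ0 _ hh hne, zero_smul] at key'
    exact smul_ne_zero hcg heg key'.symm
  rw [hhg, hφ1, one_smul] at key'
  rw [key'] at hcomul ⊢
  -- The two expressions for the coproduct of `e * g₀` now differ only in having `g₀` or `1` on the
  -- right of `e * g₀`.
  have hzero : (e * g₀) ⊗ₜ[K] (g₀ - 1) = 0 := by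
    have h1 : c g₀ • ((e * g₀) ⊗ₜ[K] g₀ + (↑u * g₀) ⊗ₜ[K] (e * g₀)) =
        c g₀ • ((e * g₀) ⊗ₜ[K] 1 + (↑u * g₀) ⊗ₜ[K] (e * g₀)) := by
      rw [map_smul, Bialgebra.comul_mul, he, (hgl g₀ hg₀).comul_eq_tmul_self, add_mul, hhg] at hcomul
      simpa [TensorProduct.smul_tmul'] using hcomul
    have h2 := smul_right_injective _ hcg h1
    rw [TensorProduct.tmul_sub, sub_eq_zero]
    exact add_right_cancel h2
  have hg1 : g₀ = 1 := by
    obtain ⟨ψ, hψ⟩ : ∃ ψ : Module.Dual K H, ψ (e * g₀) ≠ 0 := by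
      by_contra! h
      exact heg ((Module.forall_dual_apply_eq_zero_iff K _).mp h)
    have := congrArg (fun t => TensorProduct.lid K H (TensorProduct.map ψ LinearMap.id t)) hzero
    simpa [hψ, sub_eq_zero] using this
  refine ⟨by rw [hhg, hg1, mul_one], c g₀, hcg, ?_⟩
  nth_rewrite 2 [hg1]
  rw [mul_one]

end General

/-! ### The torus, its characters and the spanning monomials -/

section Monomials

variable (r s : ℂˣ)

/-- A two-dimensional representation detects `e₁`: it acts as a nilpotent matrix unit, the torus
acts diagonally with matching eigenvalue ratios, and `e₂` acts as zero, so every term of the Serre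
relations vanishes. -/
theorem e1_ne_zero : e1 r s ≠ 0 := by
  let g : Gen → Matrix (Fin 2) (Fin 2) ℂ
    | .e1 => !![0, 1; 0, 0]
    | .e2 => 0
    | .k1 => !![((s : ℂ) ^ 2)⁻¹, 0; 0, 1]
    | .k1inv => !![(s : ℂ) ^ 2, 0; 0, 1]
    | .k2 => !![(r : ℂ)⁻¹ * (s : ℂ)⁻¹, 0; 0, 1]
    | .k2inv => !![(s : ℂ) * r, 0; 0, 1]
  have hg : Sat r s g := by
    constructor <;> simp [g, Matrix.one_fin_two, mul_comm] <;> field_simp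
  intro h
  have h1 : lift r s g hg (e1 r s) = g .e1 := lift_gen ..
  rw [h, map_zero] at h1
  simpa [g] using congrFun (congrFun h1 0) 1

theorem e2_ne_zero : e2 r s ≠ 0 := by
  let g : Gen → Matrix (Fin 2) (Fin 2) ℂ
    | .e1 => 0
    | .e2 => !![0, 1; 0, 0]
    | .k1 => !![(r : ℂ) * s, 0; 0, 1]
    | .k1inv => !![(s : ℂ)⁻¹ * (r : ℂ)⁻¹, 0; 0, 1]
    | .k2 => !![(r : ℂ), 0; 0, 1]
    | .k2inv => !![(r : ℂ)⁻¹, 0; 0, 1]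
  have hg : Sat r s g := by
    constructor <;> simp [g, Matrix.one_fin_two, mul_comm] <;> field_simp
  intro h
  have h1 : lift r s g hg (e2 r s) = g .e2 := lift_gen ..
  rw [h, map_zero] at h1
  simpa [g] using congrFun (congrFun h1 0) 1

/-- `k₁` as a unit. -/
def k1Unit : (V r s)ˣ := ⟨k1 r s, k1inv r s, k1_mul_k1inv r s, k1inv_mul_k1 r s⟩

/-- `k₂` as a unit. -/
def k2Unit : (V r s)ˣ := ⟨k2 r s, k2inv r s, k2_mul_k2inv r s, k2inv_mul_k2 r s⟩

/-- The unit `k₁ᵃ k₂ᵇ`. -/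
def torus (a b : ℤ) : (V r s)ˣ := k1Unit r s ^ a * k2Unit r s ^ b

theorem commute_k2Unit_k1Unit : Commute (k2Unit r s) (k1Unit r s) :=
  Units.ext (k2_mul_k1 r s)

theorem torus_mul (a b c d : ℤ) : torus r s a b * torus r s c d = torus r s (a + c) (b + d) := by
  have := ((commute_k2Unit_k1Unit r s).zpow_zpow b c).eq
  simp only [torus, zpow_add]
  rw [mul_assoc, ← mul_assoc _ (_ ^ c), this]
  simp only [mul_assoc]

theorem torus_zero : torus r s 0 0 = 1 := by simp [torus]
theorem torus_k1 : (torus r s 1 0 : V r s) = k1 r s := by simp [torus, k1Unit]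
theorem torus_k1inv : (torus r s (-1) 0 : V r s) = k1inv r s := by simp [torus, k1Unit]
theorem torus_k2 : (torus r s 0 1 : V r s) = k2 r s := by simp [torus, k2Unit]
theorem torus_k2inv : (torus r s 0 (-1) : V r s) = k2inv r s := by simp [torus, k2Unit]

theorem torus_w1 : (torus r s 2 (-2) : V r s) = w1 r s := by
  rw [w1, pow_two, pow_two, ← torus_k1, ← torus_k2inv]
  simp only [← Units.val_mul, torus_mul]
  norm_num

theorem torus_w2 : (torus r s (-1) 2 : V r s) = w2 r s := by
  rw [w2, pow_two, ← torus_k1inv, ← torus_k2]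
  simp only [← Units.val_mul, torus_mul]
  norm_num

theorem torus_induction {p : (V r s)ˣ → Prop} (h1 : p 1) (hk1 : p (k1Unit r s))
    (hk2 : p (k2Unit r s)) (hmul : ∀ x y, p x → p y → p (x * y)) (hinv : ∀ x, p x → p x⁻¹)
    (a b : ℤ) : p (torus r s a b) :=
  let S : Subgroup (V r s)ˣ :=
    { carrier := {x | p x}, one_mem' := h1, mul_mem' := hmul _ _, inv_mem' := hinv _ }
  S.mul_mem (S.zpow_mem hk1 a) (S.zpow_mem hk2 b)

/-- The pairs `(u, q)` such that `u e = q e u`. -/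
def eigenSubgroup {A : Type*} [Ring A] [Algebra ℂ A] (e : A) : Subgroup (Aˣ × ℂˣ) where
  carrier := {p | (p.1 : A) * e = (p.2 : ℂ) • (e * p.1)}
  one_mem' := by simp
  mul_mem' := by
    rintro ⟨u, q⟩ ⟨v, t⟩ (hu : _ = _) (hv : _ = _)
    simp only [Set.mem_ofPred_eq, Prod.mk_mul_mk, Units.val_mul] at *
    rw [mul_assoc, hv, mul_smul_comm, ← mul_assoc, hu, smul_mul_assoc, smul_smul, mul_assoc,
      mul_comm]
  inv_mem' := by
    rintro ⟨u, q⟩ (hu : _ = _)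
    simp only [Set.mem_ofPred_eq, Prod.inv_mk] at *
    simpa using inv_qcomm q.ne_zero u.mul_inv u.inv_mul hu

/-- The character of the torus on `e₁`. -/
def chi1 (a b : ℤ) : ℂˣ := (s ^ 2)⁻¹ ^ a * (r⁻¹ * s⁻¹) ^ b

/-- The character of the torus on `e₂`. -/
def chi2 (a b : ℤ) : ℂˣ := (r * s) ^ a * r ^ b

theorem torus_mul_e1 (a b : ℤ) :
    (torus r s a b : V r s) * e1 r s = (chi1 r s a b : ℂ) • (e1 r s * torus r s a b) := by
  -- Pairing units with their scalars in one subgroup reduces arbitrary integer exponents to the two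
  -- generators.
  have h1 : (k1Unit r s, (s ^ 2)⁻¹) ∈ eigenSubgroup (e1 r s) := by
    simpa [eigenSubgroup, k1Unit] using k1_mul_e1 r s
  have h2 : (k2Unit r s, r⁻¹ * s⁻¹) ∈ eigenSubgroup (e1 r s) := by
    simpa [eigenSubgroup, k2Unit] using k2_mul_e1 r s
  exact mul_mem (zpow_mem h1 a) (zpow_mem h2 b)

theorem torus_mul_e2 (a b : ℤ) :
    (torus r s a b : V r s) * e2 r s = (chi2 r s a b : ℂ) • (e2 r s * torus r s a b) := by
  have h1 : (k1Unit r s, r * s) ∈ eigenSubgroup (e2 r s) := by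
    simpa [eigenSubgroup, k1Unit] using k1_mul_e2 r s
  have h2 : (k2Unit r s, r) ∈ eigenSubgroup (e2 r s) := by
    simpa [eigenSubgroup, k2Unit] using k2_mul_e2 r s
  exact mul_mem (zpow_mem h1 a) (zpow_mem h2 b)

theorem isGroupLikeElem_k1 : IsGroupLikeElem ℂ (k1 r s) :=
  ⟨lift_gen _ _ _ (sat_counit r s) .k1, lift_gen _ _ _ (sat_comul r s) .k1⟩

theorem isGroupLikeElem_k2 : IsGroupLikeElem ℂ (k2 r s) :=
  ⟨lift_gen _ _ _ (sat_counit r s) .k2, lift_gen _ _ _ (sat_comul r s) .k2⟩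

theorem comul_e1 : Coalgebra.comul (R := ℂ) (e1 r s) = e1 r s ⊗ₜ[ℂ] 1 + w1 r s ⊗ₜ[ℂ] e1 r s :=
  lift_gen _ _ _ (sat_comul r s) .e1

theorem comul_e2 : Coalgebra.comul (R := ℂ) (e2 r s) = e2 r s ⊗ₜ[ℂ] 1 + w2 r s ⊗ₜ[ℂ] e2 r s :=
  lift_gen _ _ _ (sat_comul r s) .e2

theorem isGroupLikeElem_torus (a b : ℤ) : IsGroupLikeElem ℂ (torus r s a b : V r s) := by
  refine torus_induction r s (p := fun u => IsGroupLikeElem ℂ (u : V r s)) .one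
    (isGroupLikeElem_k1 r s) (isGroupLikeElem_k2 r s) (fun x y hx hy => ?_) (fun x hx => ?_) a b
  · simpa using hx.mul hy
  · simpa using hx

/-- Monomials: words in `e₁`, `e₂` followed by `k₁ᵃ k₂ᵇ`, with their weight. -/
inductive IsMonomial : ℕ × ℕ → V r s → Prop
  | base (a b : ℤ) : IsMonomial 0 (torus r s a b)
  | e1_mul {μ x} : IsMonomial μ x → IsMonomial (μ + (1, 0)) (e1 r s * x)
  | e2_mul {μ x} : IsMonomial μ x → IsMonomial (μ + (0, 1)) (e2 r s * x)

variable {r s}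

theorem IsMonomial.eq_torus {x : V r s} (h : IsMonomial r s 0 x) : ∃ a b, x = torus r s a b := by
  generalize hμ : (0 : ℕ × ℕ) = μ at h
  cases h with
  | base a b => exact ⟨a, b, rfl⟩
  | e1_mul h => simp [Prod.ext_iff] at hμ
  | e2_mul h => simp [Prod.ext_iff] at hμ

theorem IsMonomial.eq_e1_mul {x : V r s} (h : IsMonomial r s (1, 0) x) :
    ∃ a b, x = e1 r s * torus r s a b := by
  generalize hμ : ((1, 0) : ℕ × ℕ) = μ at h
  cases h with
  | base a b => simp [Prod.ext_iff] at hμ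
  | @e1_mul ν x h =>
    obtain rfl : ν = 0 := by simpa using hμ
    obtain ⟨a, b, rfl⟩ := h.eq_torus
    exact ⟨a, b, rfl⟩
  | e2_mul h => simp [Prod.ext_iff] at hμ

theorem IsMonomial.eq_e2_mul {x : V r s} (h : IsMonomial r s (0, 1) x) :
    ∃ a b, x = e2 r s * torus r s a b := by
  generalize hμ : ((0, 1) : ℕ × ℕ) = μ at h
  cases h with
  | base a b => simp [Prod.ext_iff] at hμ
  | e1_mul h => simp [Prod.ext_iff] at hμ
  | @e2_mul ν x h =>
    obtain rfl : ν = 0 := by simpa using hμ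
    obtain ⟨a, b, rfl⟩ := h.eq_torus
    exact ⟨a, b, rfl⟩

variable (r s) in
/-- The set of all monomials. -/
def monomials : Set (V r s) := {x | ∃ μ, IsMonomial r s μ x}

/-- Moving `k₁ᵃ k₂ᵇ` rightwards past each letter costs only a scalar, and it merges with the torus
part at the end of the word. -/
theorem IsMonomial.torus_mul_mem {μ : ℕ × ℕ} {x : V r s} (h : IsMonomial r s μ x) (a b : ℤ) :
    torus r s a b * x ∈ Submodule.span ℂ (monomials r s) ∧
      ∃ (c : ℂ) (y : V r s), IsMonomial r s μ y ∧ torus r s a b * x = c • y := by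
  suffices ∃ (c : ℂ) (y : V r s), IsMonomial r s μ y ∧ torus r s a b * x = c • y by
    refine ⟨?_, this⟩
    obtain ⟨c, y, hy, h⟩ := this
    exact h ▸ Submodule.smul_mem _ _ (Submodule.subset_span ⟨_, hy⟩)
  induction h with
  | base c d => exact ⟨1, _, .base (a + c) (b + d), by simp [← Units.val_mul, torus_mul]⟩
  | e1_mul h ih =>
    obtain ⟨c, y, hy, h⟩ := ih
    exact ⟨chi1 r s a b * c, _, hy.e1_mul, by
      rw [← mul_assoc, torus_mul_e1, smul_mul_assoc, mul_assoc, h, mul_smul_comm, smul_smul]⟩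
  | e2_mul h ih =>
    obtain ⟨c, y, hy, h⟩ := ih
    exact ⟨chi2 r s a b * c, _, hy.e2_mul, by
      rw [← mul_assoc, torus_mul_e2, smul_mul_assoc, mul_assoc, h, mul_smul_comm, smul_smul]⟩

/-- The span contains `1` and is stable under left multiplication by each generator, hence by all of
`V`. -/
theorem span_monomials : Submodule.span ℂ (monomials r s) = ⊤ := by
  have key : ∀ a : V r s, ∀ x ∈ Submodule.span ℂ (monomials r s),
      a * x ∈ Submodule.span ℂ (monomials r s) := by
    intro a
    induction a using V.induction with
    | hc c =>
      intro x hx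
      rw [← Algebra.smul_def]
      exact Submodule.smul_mem _ _ hx
    | hadd a b ha hb =>
      intro x hx
      rw [add_mul]
      exact add_mem (ha x hx) (hb x hx)
    | hmul a b ha hb =>
      intro x hx
      rw [mul_assoc]
      exact ha _ (hb x hx)
    | hg g =>
      intro x hx
      refine Submodule.span_le (p := (Submodule.span ℂ (monomials r s)).comap
        (LinearMap.mulLeft ℂ (gen r s g))) |>.mpr ?_ hx
      rintro y ⟨μ, hy⟩
      change gen r s g * y ∈ Submodule.span ℂ (monomials r s)
      cases g
      · exact Submodule.subset_span ⟨_, hy.e1_mul⟩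
      · exact Submodule.subset_span ⟨_, hy.e2_mul⟩
      · exact show k1 r s * y ∈ Submodule.span ℂ (monomials r s) from
          torus_k1 r s ▸ (hy.torus_mul_mem 1 0).1
      · exact show k1inv r s * y ∈ Submodule.span ℂ (monomials r s) from
          torus_k1inv r s ▸ (hy.torus_mul_mem (-1) 0).1
      · exact show k2 r s * y ∈ Submodule.span ℂ (monomials r s) from
          torus_k2 r s ▸ (hy.torus_mul_mem 0 1).1
      · exact show k2inv r s * y ∈ Submodule.span ℂ (monomials r s) from
          torus_k2inv r s ▸ (hy.torus_mul_mem 0 (-1)).1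
  refine eq_top_iff.mpr fun a _ => ?_
  have h1 : (1 : V r s) ∈ Submodule.span ℂ (monomials r s) :=
    Submodule.subset_span ⟨0, by simpa [torus_zero] using IsMonomial.base (r := r) (s := s) 0 0⟩
  simpa using key a 1 h1

/-! ### Weights for conjugation by `k₁`, and the group-like elements -/

variable (r s) in
/-- Conjugation by `k₁`. -/
def conjK1 : V r s →ₗ[ℂ] V r s :=
  LinearMap.mulLeft ℂ (k1 r s) ∘ₗ LinearMap.mulRight ℂ (k1inv r s)

theorem conjK1_apply (x : V r s) : conjK1 r s x = k1 r s * (x * k1inv r s) := rfl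

theorem conjK1_eq_smul_iff {x : V r s} {c : ℂ} :
    conjK1 r s x = c • x ↔ k1 r s * x = c • (x * k1 r s) := by
  rw [conjK1_apply, ← mul_assoc]
  constructor
  · intro h
    have := congrArg (· * k1 r s) h
    simpa [mul_assoc, k1inv_mul_k1] using this
  · intro h
    rw [h, smul_mul_assoc, mul_assoc, k1_mul_k1inv, mul_one]

theorem conjK1_mul (x y : V r s) : conjK1 r s (x * y) = conjK1 r s x * conjK1 r s y := by
  simp [conjK1_apply, mul_assoc, k1inv_mul_k1_assoc]

theorem conjK1_injective : Function.Injective (conjK1 r s) := by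
  intro x y h
  have := congrArg (fun z => k1inv r s * (z * k1 r s)) h
  simpa [conjK1_apply, mul_assoc, k1inv_mul_k1, k1inv_mul_k1_assoc] using this

variable (r s) in
/-- The eigenvalue of conjugation by `k₁` in weight `μ`. -/
def chi (μ : ℕ × ℕ) : ℂˣ := (s ^ 2)⁻¹ ^ μ.1 * (r * s) ^ μ.2

theorem chi_add (μ ν : ℕ × ℕ) : chi r s (μ + ν) = chi r s μ * chi r s ν := by
  simp only [chi, Prod.fst_add, Prod.snd_add, pow_add]
  exact mul_mul_mul_comm ..

theorem conjK1_torus (a b : ℤ) : conjK1 r s (torus r s a b) = torus r s a b := by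
  rw [conjK1_apply, ← torus_k1, ← torus_k1inv]
  simp only [← Units.val_mul, torus_mul]
  norm_num

theorem conjK1_e1 : conjK1 r s (e1 r s) = (chi r s (1, 0) : ℂ) • e1 r s :=
  conjK1_eq_smul_iff.mpr (by simpa [chi] using k1_mul_e1 r s)

theorem conjK1_e2 : conjK1 r s (e2 r s) = (chi r s (0, 1) : ℂ) • e2 r s :=
  conjK1_eq_smul_iff.mpr (by simpa [chi] using k1_mul_e2 r s)

theorem IsMonomial.conjK1_eq {μ : ℕ × ℕ} {x : V r s} (h : IsMonomial r s μ x) :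
    conjK1 r s x = (chi r s μ : ℂ) • x := by
  induction h with
  | base a b => simp [conjK1_torus, chi]
  | e1_mul h ih =>
    rw [conjK1_mul, ih, conjK1_e1, smul_mul_smul_comm, chi_add, Units.val_mul,
      mul_comm (chi r s _ : ℂ)]
  | e2_mul h ih =>
    rw [conjK1_mul, ih, conjK1_e2, smul_mul_smul_comm, chi_add, Units.val_mul,
      mul_comm (chi r s _ : ℂ)]

theorem chi_eq_zpow (μ : ℕ × ℕ) : chi r s μ = r ^ (μ.2 : ℤ) * s ^ ((μ.2 : ℤ) - 2 * μ.1) := by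
  rw [chi, zpow_sub, mul_pow, zpow_mul]
  simp [mul_comm, mul_assoc]

/-- The exponents in `r ^ j * s ^ (j - 2 i)` determine `(i, j)`, also after scaling by `n > 0`. The
version with powers is what periodicity under conjugation calls for. -/
theorem chi_pow_injective (hrs : ∀ m n : ℤ, r ^ m * s ^ n = 1 → m = 0 ∧ n = 0) {n : ℕ}
    (hn : 0 < n) {μ ν : ℕ × ℕ} (h : chi r s μ ^ n = chi r s ν ^ n) : μ = ν := by
  have : r ^ (((μ.2 : ℤ) - ν.2) * n) * s ^ ((((μ.2 : ℤ) - 2 * μ.1) - (ν.2 - 2 * ν.1)) * n) = 1 := by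
    rw [zpow_mul, zpow_mul, zpow_natCast, zpow_natCast, ← mul_pow, zpow_sub, zpow_sub s,
      ← div_eq_mul_inv, ← div_eq_mul_inv, div_mul_div_comm, ← chi_eq_zpow, ← chi_eq_zpow, div_pow,
      h, div_self']
  obtain ⟨h1, h2⟩ := hrs _ _ this
  have hn' : (n : ℤ) ≠ 0 := by exact_mod_cast hn.ne'
  have h1 := (mul_eq_zero.mp h1).resolve_right hn'
  have h2 := (mul_eq_zero.mp h2).resolve_right hn'
  ext <;> omega

theorem chi_injective (hrs : ∀ m n : ℤ, r ^ m * s ^ n = 1 → m = 0 ∧ n = 0) :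
    Function.Injective (chi r s) :=
  fun μ ν h => chi_pow_injective hrs one_pos (by rw [h])

theorem IsMonomial.conjK1_pow {μ : ℕ × ℕ} {x : V r s} (h : IsMonomial r s μ x) (n : ℕ) :
    (conjK1 r s ^ n) x = (chi r s μ : ℂ) ^ n • x := by
  induction n with
  | zero => simp
  | succ n ih => rw [pow_succ', Module.End.mul_apply, ih, map_smul, h.conjK1_eq, smul_smul, pow_succ]

/-- Every group-like element is of the form `k₁ᵃ k₂ᵇ`. -/
theorem eq_torus_of_isGroupLikeElem (hrs : ∀ m n : ℤ, r ^ m * s ^ n = 1 → m = 0 ∧ n = 0)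
    {g : V r s} (hg : IsGroupLikeElem ℂ g) : ∃ a b, g = torus r s a b := by
  have hmem : g ∈ Submodule.span ℂ (monomials r s) := span_monomials (r := r) (s := s) ▸ trivial
  have hX : ∀ x ∈ monomials r s, ∃ c : ℂ, conjK1 r s x = c • x :=
    fun x ⟨μ, hx⟩ => ⟨_, hx.conjK1_eq⟩
  obtain ⟨n, hn, hgn⟩ := exists_iterate_eq_of_isGroupLikeElem (conjK1 r s) conjK1_injective
    (fun g hg => (isGroupLikeElem_k1 r s).mul (hg.mul
      ((isGroupLikeElem_k1 r s).of_mul_eq_one (k1_mul_k1inv r s) (k1inv_mul_k1 r s)))) hX hg hmem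
  -- Periodicity makes `g` a fixed vector of the `n`-th power of the conjugation, which only
  -- monomials of weight zero can contribute to.
  have hspan := mem_span_inter_eigenspace (conjK1 r s ^ n)
    (X := monomials r s) (fun x ⟨μ, hx⟩ => ⟨_, hx.conjK1_pow n⟩) hmem (c := 1) (by simpa using hgn)
  have hsub : {x ∈ monomials r s | (conjK1 r s ^ n) x = (1 : ℂ) • x} ⊆
      -- Zero is added because monomials are not known to be nonzero; it does not change the span.
      insert 0 {x | ∃ a b, x = torus r s a b} := by
    rintro x ⟨⟨μ, hx⟩, hx1⟩
    rw [hx.conjK1_pow] at hx1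
    by_cases hx0 : x = 0
    · exact Or.inl hx0
    · have h1 := smul_left_injective ℂ hx0 hx1
      have hμ : μ = 0 := chi_pow_injective hrs hn (ν := 0) (by
        ext
        simpa [chi] using h1)
      subst hμ
      exact Or.inr hx.eq_torus
  have hspan' := Submodule.span_mono hsub hspan
  rw [Submodule.span_insert_zero] at hspan'
  by_contra hne
  have hli : LinearIndepOn ℂ id (insert g {x : V r s | ∃ a b, x = torus r s a b}) := by
    refine linearIndepOn_isGroupLikeElem.mono ?_
    rintro x (rfl | ⟨a, b, rfl⟩)
    · exact hg
    · exact isGroupLikeElem_torus r s a b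
  have := hli.notMem_span_of_insert hne
  rw [Set.image_id] at this
  exact this hspan'

end Monomials

/-! ### Rescaling automorphisms -/

section Automorphisms

variable (r s : ℂˣ)

/-- The images of the generators under the rescaling of `e₁` and `e₂`. -/
def scaleGen (c₁ c₂ : ℂ) : Gen → V r s
  | .e1 => c₁ • e1 r s
  | .e2 => c₂ • e2 r s
  | .k1 => k1 r s
  | .k1inv => k1inv r s
  | .k2 => k2 r s
  | .k2inv => k2inv r s

/-- The Serre relations are homogeneous, of degrees `(2, 1)` and `(1, 3)` in `(e₁, e₂)`. The scalars
may vanish: `c₁ = c₂ = 0` gives the projection onto the torus part used as `P` in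
`skewPrimitive_eq_smul`. -/
theorem sat_scaleGen (c₁ c₂ : ℂ) : Sat r s (scaleGen r s c₁ c₂) where
  k1_mul_inv := k1_mul_k1inv r s
  k1_inv_mul := k1inv_mul_k1 r s
  k2_mul_inv := k2_mul_k2inv r s
  k2_inv_mul := k2inv_mul_k2 r s
  k1_k2 := (k2_mul_k1 r s).symm
  k1_e1 := by simp [scaleGen, k1_mul_e1, smul_comm c₁]
  k1_e2 := by simp [scaleGen, k1_mul_e2, smul_comm c₂]
  k2_e1 := by simp [scaleGen, k2_mul_e1, smul_comm c₁]
  k2_e2 := by simp [scaleGen, k2_mul_e2, smul_comm c₂]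
  serre1 := by
    have h := congrArg (fun x => (c₁ ^ 2 * c₂) • x) (serre1_V r s)
    rw [smul_zero] at h
    rw [← h]
    simp only [scaleGen, pow_succ, pow_zero, one_mul, smul_mul_assoc, mul_smul_comm, smul_smul,
      smul_add, smul_sub]
    match_scalars <;> ring
  serre2 := by
    have h := congrArg (fun x => (c₁ * c₂ ^ 3) • x) (serre2_V r s)
    rw [smul_zero] at h
    rw [← h]
    simp only [scaleGen, pow_succ, pow_zero, one_mul, smul_mul_assoc, mul_smul_comm, smul_smul,
      smul_add, smul_sub]
    match_scalars <;> ring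

/-- The endomorphism rescaling `e₁` and `e₂` and fixing `k₁` and `k₂`. -/
def scaleHom (c₁ c₂ : ℂ) : V r s →ₐ[ℂ] V r s := lift r s _ (sat_scaleGen r s c₁ c₂)

theorem scaleHom_gen (c₁ c₂ : ℂ) (x : Gen) :
    scaleHom r s c₁ c₂ (gen r s x) = scaleGen r s c₁ c₂ x := lift_gen ..

theorem scaleHom_e1 (c₁ c₂ : ℂ) : scaleHom r s c₁ c₂ (e1 r s) = c₁ • e1 r s := lift_gen ..
theorem scaleHom_e2 (c₁ c₂ : ℂ) : scaleHom r s c₁ c₂ (e2 r s) = c₂ • e2 r s := lift_gen ..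
theorem scaleHom_k1 (c₁ c₂ : ℂ) : scaleHom r s c₁ c₂ (k1 r s) = k1 r s := lift_gen ..
theorem scaleHom_k2 (c₁ c₂ : ℂ) : scaleHom r s c₁ c₂ (k2 r s) = k2 r s := lift_gen ..
theorem scaleHom_k1inv (c₁ c₂ : ℂ) : scaleHom r s c₁ c₂ (k1inv r s) = k1inv r s := lift_gen ..
theorem scaleHom_k2inv (c₁ c₂ : ℂ) : scaleHom r s c₁ c₂ (k2inv r s) = k2inv r s := lift_gen ..

theorem scaleHom_torus (c₁ c₂ : ℂ) (a b : ℤ) :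
    scaleHom r s c₁ c₂ (torus r s a b) = torus r s a b := by
  have : Units.map (scaleHom r s c₁ c₂ : V r s →* V r s) (torus r s a b) = torus r s a b := by
    refine torus_induction r s (p := fun u => Units.map (scaleHom r s c₁ c₂ : V r s →* V r s) u = u)
      (map_one _) (Units.ext (scaleHom_k1 ..)) (Units.ext (scaleHom_k2 ..))
      (fun x y hx hy => ?_) (fun x hx => ?_) a b
    · rw [map_mul, hx, hy]
    · rw [map_inv, hx]
  exact congrArg Units.val this

theorem scaleHom_one : scaleHom r s 1 1 = AlgHom.id ℂ _ := by
  refine algHom_ext fun x => ?_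
  rw [scaleHom_gen]
  cases x <;> simp [scaleGen] <;> rfl

theorem scaleHom_comp (c₁ c₂ d₁ d₂ : ℂ) :
    (scaleHom r s c₁ c₂).comp (scaleHom r s d₁ d₂) = scaleHom r s (c₁ * d₁) (c₂ * d₂) := by
  refine algHom_ext fun x => ?_
  rw [AlgHom.comp_apply, scaleHom_gen, scaleHom_gen]
  cases x <;> simp [scaleGen, scaleHom_e1, scaleHom_e2, scaleHom_k1, scaleHom_k2, scaleHom_k1inv,
    scaleHom_k2inv, smul_smul, mul_comm]

theorem comulHom_scaleHom (c₁ c₂ : ℂ) : (comulHom r s).comp (scaleHom r s c₁ c₂) =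
    (Algebra.TensorProduct.map (scaleHom r s c₁ c₂) (scaleHom r s c₁ c₂)).comp (comulHom r s) := by
  refine algHom_ext fun x => ?_
  have h (x) : comulHom r s (gen r s x) = comulGen r s x := lift_gen _ _ _ _ _
  have he1 : comulHom r s (e1 r s) = _ := h .e1
  have he2 : comulHom r s (e2 r s) = _ := h .e2
  have hk1 : comulHom r s (k1 r s) = _ := h .k1
  have hk2 : comulHom r s (k2 r s) = _ := h .k2
  have hk1i : comulHom r s (k1inv r s) = _ := h .k1inv
  have hk2i : comulHom r s (k2inv r s) = _ := h .k2inv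
  rw [AlgHom.comp_apply, AlgHom.comp_apply, scaleHom_gen, h]
  cases x <;> simp [scaleGen, comulGen, he1, he2, hk1, hk2, hk1i, hk2i, scaleHom_e1, scaleHom_e2,
    scaleHom_k1, scaleHom_k2, scaleHom_k1inv, scaleHom_k2inv, ← torus_w1, ← torus_w2,
    scaleHom_torus, TensorProduct.smul_tmul']

theorem counitHom_scaleHom (c₁ c₂ : ℂ) :
    (counitHom r s).comp (scaleHom r s c₁ c₂) = counitHom r s := by
  refine algHom_ext fun x => ?_
  have h (x) : counitHom r s (gen r s x) = counitGen x := lift_gen _ _ _ _ _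
  rw [AlgHom.comp_apply, scaleHom_gen, h]
  cases x <;> simp [scaleGen, counitGen, e1, e2, k1, k2, k1inv, k2inv, h]

theorem antipodeLin_scaleHom (c₁ c₂ : ℂ) (a : V r s) :
    antipodeLin r s (scaleHom r s c₁ c₂ a) = scaleHom r s c₁ c₂ (antipodeLin r s a) := by
  induction a using V.induction with
  | hc c => simp [antipodeLin_algebraMap]
  | hadd a b ha hb => simp [ha, hb]
  | hmul a b ha hb => simp [antipodeLin_mul, ha, hb]
  | hg x =>
    have h := antipodeLin_gen r s
    have he1 : antipodeLin r s (e1 r s) = _ := h .e1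
    have he2 : antipodeLin r s (e2 r s) = _ := h .e2
    have hk1 : antipodeLin r s (k1 r s) = _ := h .k1
    have hk2 : antipodeLin r s (k2 r s) = _ := h .k2
    have hk1i : antipodeLin r s (k1inv r s) = _ := h .k1inv
    have hk2i : antipodeLin r s (k2inv r s) = _ := h .k2inv
    rw [h, scaleHom_gen]
    cases x <;> simp [scaleGen, antipodeGen, w1inv, w2inv, he1, he2, hk1, hk2, hk1i, hk2i,
      scaleHom_e1, scaleHom_e2, scaleHom_k1, scaleHom_k2, scaleHom_k1inv, scaleHom_k2inv]

/-- The Hopf algebra automorphism rescaling `e₁` and `e₂`. -/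
def scaleAut (γ : ℂˣ × ℂˣ) : HopfAut ℂ (V r s) where
  val := AlgEquiv.ofAlgHom (scaleHom r s γ.1 γ.2) (scaleHom r s (γ.1⁻¹ : ℂˣ) (γ.2⁻¹ : ℂˣ))
    (by rw [scaleHom_comp]; simp [scaleHom_one]) (by rw [scaleHom_comp]; simp [scaleHom_one])
  property :=
    ⟨fun a => DFunLike.congr_fun (comulHom_scaleHom r s γ.1 γ.2) a,
      fun a => DFunLike.congr_fun (counitHom_scaleHom r s γ.1 γ.2) a,
      fun a => antipodeLin_scaleHom r s γ.1 γ.2 a⟩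

theorem scaleAut_apply (γ : ℂˣ × ℂˣ) (a : V r s) :
    (scaleAut r s γ : V r s ≃ₐ[ℂ] V r s) a = scaleHom r s γ.1 γ.2 a := rfl

/-- The rescaling automorphisms, as a group homomorphism. -/
def scaleMonoidHom : ℂˣ × ℂˣ →* HopfAut ℂ (V r s) where
  toFun := scaleAut r s
  map_one' := Subtype.ext (AlgEquiv.ext fun a => by
    rw [scaleAut_apply]
    simp [scaleHom_one])
  map_mul' γ δ := Subtype.ext (AlgEquiv.ext fun a => by
    rw [Subgroup.coe_mul, AlgEquiv.mul_apply, scaleAut_apply, scaleAut_apply, scaleAut_apply,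
      ← AlgHom.comp_apply, scaleHom_comp]
    simp)

theorem scaleMonoidHom_injective : Function.Injective (scaleMonoidHom r s) := by
  intro γ δ h
  have h1 (a : V r s) : scaleHom r s γ.1 γ.2 a = scaleHom r s δ.1 δ.2 a :=
    congrArg (fun θ : HopfAut ℂ (V r s) => (θ : V r s ≃ₐ[ℂ] V r s) a) h
  have h2 := h1 (e1 r s)
  have h3 := h1 (e2 r s)
  rw [scaleHom_e1, scaleHom_e1] at h2
  rw [scaleHom_e2, scaleHom_e2] at h3
  exact Prod.ext (Units.ext (smul_left_injective ℂ (e1_ne_zero r s) h2))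
    (Units.ext (smul_left_injective ℂ (e2_ne_zero r s) h3))

/-! ### Rigidity of Hopf automorphisms -/

variable {r s}

theorem isGroupLikeElem_of_mem_hopfAut {θ : V r s ≃ₐ[ℂ] V r s} (hθ : θ ∈ HopfAut ℂ (V r s))
    {g : V r s} (hg : IsGroupLikeElem ℂ g) : IsGroupLikeElem ℂ (θ g) :=
  ⟨by rw [hθ.2.1, hg.counit_eq_one], by rw [hθ.1, hg.comul_eq_tmul_self]; rfl⟩

/-- Distinct weights have distinct eigenvalues, so conjugation by `k₁` alone separates them. -/
theorem mem_span_of_conjK1_eq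
    (hrs : ∀ m n : ℤ, r ^ m * s ^ n = 1 → m = 0 ∧ n = 0)
    {v : V r s} {μ : ℕ × ℕ} (hv : conjK1 r s v = (chi r s μ : ℂ) • v) :
    v ∈ Submodule.span ℂ {x | IsMonomial r s μ x} := by
  have h := mem_span_inter_eigenspace (conjK1 r s) (X := monomials r s)
    (fun x ⟨μ, hx⟩ => ⟨_, hx.conjK1_eq⟩)
    (v := v) (span_monomials (r := r) (s := s) ▸ trivial) hv
  have hsub : {x ∈ monomials r s | conjK1 r s x = (chi r s μ : ℂ) • x} ⊆
      insert 0 {x | IsMonomial r s μ x} := by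
    rintro x ⟨⟨ν, hx⟩, hx1⟩
    rw [hx.conjK1_eq] at hx1
    by_cases hx0 : x = 0
    · exact Or.inl hx0
    · obtain rfl := chi_injective hrs (Units.ext (smul_left_injective ℂ hx0 hx1))
      exact Or.inr hx
  have h' := Submodule.span_mono hsub h
  rwa [Submodule.span_insert_zero] at h'

/-- Weight `(1, 0)` forces `v = e₁ p` with `p` a combination of group-like elements, which is the
situation of `skewPrimitive_eq_smul`. -/
theorem skewPrimitive_e1
    (hrs : ∀ m n : ℤ, r ^ m * s ^ n = 1 → m = 0 ∧ n = 0)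
    {v h : V r s} (hv0 : v ≠ 0)
    (hv : conjK1 r s v = (chi r s (1, 0) : ℂ) • v) (hh : IsGroupLikeElem ℂ h)
    (hcomul : Coalgebra.comul (R := ℂ) v = v ⊗ₜ[ℂ] 1 + h ⊗ₜ[ℂ] v) :
    h = w1 r s ∧ ∃ c : ℂ, c ≠ 0 ∧ v = c • e1 r s := by
  obtain ⟨p, hp, rfl⟩ : ∃ p ∈ Submodule.span ℂ {g : V r s | IsGroupLikeElem ℂ g},
      e1 r s * p = v := by
    refine (Submodule.span_le (p := (Submodule.span ℂ {g : V r s | IsGroupLikeElem ℂ g}).map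
      (LinearMap.mulLeft ℂ (e1 r s)))).mpr ?_ (mem_span_of_conjK1_eq hrs hv)
    intro x hx
    obtain ⟨a, b, rfl⟩ := hx.eq_e1_mul
    exact ⟨_, Submodule.subset_span (isGroupLikeElem_torus r s a b), rfl⟩
  refine skewPrimitive_eq_smul (P := scaleHom r s 0 0) (fun g hg => ?_) ?_ (comul_e1 r s)
    (torus_w1 r s ▸ isGroupLikeElem_torus r s _ _) hh hp hv0 hcomul
  · obtain ⟨a, b, rfl⟩ := eq_torus_of_isGroupLikeElem hrs hg
    exact scaleHom_torus ..
  · rw [scaleHom_e1, zero_smul]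

theorem skewPrimitive_e2
    (hrs : ∀ m n : ℤ, r ^ m * s ^ n = 1 → m = 0 ∧ n = 0)
    {v h : V r s} (hv0 : v ≠ 0)
    (hv : conjK1 r s v = (chi r s (0, 1) : ℂ) • v) (hh : IsGroupLikeElem ℂ h)
    (hcomul : Coalgebra.comul (R := ℂ) v = v ⊗ₜ[ℂ] 1 + h ⊗ₜ[ℂ] v) :
    h = w2 r s ∧ ∃ c : ℂ, c ≠ 0 ∧ v = c • e2 r s := by
  obtain ⟨p, hp, rfl⟩ : ∃ p ∈ Submodule.span ℂ {g : V r s | IsGroupLikeElem ℂ g},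
      e2 r s * p = v := by
    refine (Submodule.span_le (p := (Submodule.span ℂ {g : V r s | IsGroupLikeElem ℂ g}).map
      (LinearMap.mulLeft ℂ (e2 r s)))).mpr ?_ (mem_span_of_conjK1_eq hrs hv)
    intro x hx
    obtain ⟨a, b, rfl⟩ := hx.eq_e2_mul
    exact ⟨_, Submodule.subset_span (isGroupLikeElem_torus r s a b), rfl⟩
  refine skewPrimitive_eq_smul (P := scaleHom r s 0 0) (fun g hg => ?_) ?_ (comul_e2 r s)
    (torus_w2 r s ▸ isGroupLikeElem_torus r s _ _) hh hp hv0 hcomul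
  · obtain ⟨a, b, rfl⟩ := eq_torus_of_isGroupLikeElem hrs hg
    exact scaleHom_torus ..
  · rw [scaleHom_e2, zero_smul]

/-- A Hopf algebra automorphism sends common eigenvectors of the torus to weight vectors. -/
theorem exists_weight
    (hrs : ∀ m n : ℤ, r ^ m * s ^ n = 1 → m = 0 ∧ n = 0)
    {θ : V r s ≃ₐ[ℂ] V r s} (hθ : θ ∈ HopfAut ℂ (V r s)) {e : V r s}
    (he0 : e ≠ 0) (he : ∀ a b, ∃ c : ℂ, torus r s a b * e = c • (e * torus r s a b)) :
    ∃ μ, conjK1 r s (θ e) = (chi r s μ : ℂ) • θ e := by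
  -- The preimage of `k₁` is some `k₁ᵃ k₂ᵇ`, which commutes with `e` up to a scalar; applying `θ`
  -- makes `θ e` an eigenvector of conjugation by `k₁`.
  obtain ⟨a, b, hab⟩ := eq_torus_of_isGroupLikeElem hrs
    (isGroupLikeElem_of_mem_hopfAut (inv_mem hθ) (isGroupLikeElem_k1 r s))
  have hk : θ (torus r s a b) = k1 r s := by
    rw [← hab]
    exact θ.apply_symm_apply _
  obtain ⟨c, hc⟩ := he a b
  have hc' : conjK1 r s (θ e) = c • θ e := conjK1_eq_smul_iff.mpr (by
    rw [← hk, ← map_mul, hc, map_smul, map_mul])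
  obtain ⟨x, ⟨μ, hx⟩, hxc, hx0⟩ := exists_mem_eigenvector (conjK1 r s) (X := monomials r s)
    (fun x ⟨μ, hx⟩ => ⟨_, hx.conjK1_eq⟩) (span_monomials (r := r) (s := s) ▸ trivial) hc'
    (by simpa using he0)
  rw [hx.conjK1_eq] at hxc
  exact ⟨μ, by rw [hc', smul_left_injective ℂ hx0 hxc]⟩

/-- The images under `θ` of the monomials span `V` and are eigenvectors whose weights are
combinations of `μ₁` and `μ₂`, the torus part staying in weight zero. Every eigenvalue must occur
among theirs. -/
theorem weight_eq_of_surjective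
    (hrs : ∀ m n : ℤ, r ^ m * s ^ n = 1 → m = 0 ∧ n = 0)
    {θ : V r s ≃ₐ[ℂ] V r s} (hθ : θ ∈ HopfAut ℂ (V r s))
    {μ₁ μ₂ : ℕ × ℕ} (h₁ : conjK1 r s (θ (e1 r s)) = (chi r s μ₁ : ℂ) • θ (e1 r s))
    (h₂ : conjK1 r s (θ (e2 r s)) = (chi r s μ₂ : ℂ) • θ (e2 r s)) {v : V r s} (hv0 : v ≠ 0)
    {ρ : ℕ × ℕ} (hv : conjK1 r s v = (chi r s ρ : ℂ) • v) : ∃ m n : ℕ, ρ = m • μ₁ + n • μ₂ := by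
  have hmon : ∀ ν x, IsMonomial r s ν x →
      conjK1 r s (θ x) = (chi r s (ν.1 • μ₁ + ν.2 • μ₂) : ℂ) • θ x := by
    intro ν x hx
    induction hx with
    | base a b =>
      obtain ⟨c, d, h⟩ := eq_torus_of_isGroupLikeElem hrs
        (isGroupLikeElem_of_mem_hopfAut hθ (isGroupLikeElem_torus r s a b))
      rw [h, conjK1_torus]
      simp [chi]
    | @e1_mul ν x hx ih =>
      have : (ν + (1, 0)).1 • μ₁ + (ν + (1, 0)).2 • μ₂ = μ₁ + (ν.1 • μ₁ + ν.2 • μ₂) := by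
        simp only [Prod.fst_add, Prod.snd_add, add_smul, one_smul, zero_smul]
        abel
      rw [this, map_mul, conjK1_mul, ih, h₁, smul_mul_smul_comm, chi_add μ₁, Units.val_mul]
    | @e2_mul ν x hx ih =>
      have : (ν + (0, 1)).1 • μ₁ + (ν + (0, 1)).2 • μ₂ = μ₂ + (ν.1 • μ₁ + ν.2 • μ₂) := by
        simp only [Prod.fst_add, Prod.snd_add, add_smul, one_smul, zero_smul]
        abel
      rw [this, map_mul, conjK1_mul, ih, h₂, smul_mul_smul_comm, chi_add μ₂, Units.val_mul]
  have hspan : v ∈ Submodule.span ℂ (θ.toLinearMap '' monomials r s) := by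
    rw [Submodule.span_image, span_monomials, Submodule.map_top]
    exact θ.surjective v
  obtain ⟨_, ⟨x, ⟨ν, hx⟩, rfl⟩, hxc, hx0⟩ := exists_mem_eigenvector (conjK1 r s)
    (by rintro _ ⟨x, ⟨ν, hx⟩, rfl⟩; exact ⟨_, hmon ν x hx⟩) hspan hv hv0
  have h := (hmon ν x hx).symm.trans hxc
  exact ⟨ν.1, ν.2, (chi_injective hrs (Units.ext (smul_left_injective ℂ hx0 h))).symm⟩

/-- `(1, 0)` is indecomposable in the monoid `ℕ × ℕ`. -/
theorem eq_of_smul_add_smul_eq_one_zero {μ₁ μ₂ : ℕ × ℕ} {m n : ℕ}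
    (h : ((1, 0) : ℕ × ℕ) = m • μ₁ + n • μ₂) : μ₁ = (1, 0) ∨ μ₂ = (1, 0) := by
  obtain ⟨a, b⟩ := μ₁
  obtain ⟨c, d⟩ := μ₂
  simp only [Prod.smul_mk, Prod.mk_add_mk, Prod.mk.injEq, smul_eq_mul] at h ⊢
  obtain ⟨h1, h2⟩ := h
  rcases (by omega : m * a = 1 ∨ n * c = 1) with h | h
  · obtain ⟨rfl, rfl⟩ := mul_eq_one.mp h
    exact Or.inl ⟨rfl, by omega⟩
  · obtain ⟨rfl, rfl⟩ := mul_eq_one.mp h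
    exact Or.inr ⟨rfl, by omega⟩

theorem eq_of_smul_add_smul_eq_zero_one {μ₁ μ₂ : ℕ × ℕ} {m n : ℕ}
    (h : ((0, 1) : ℕ × ℕ) = m • μ₁ + n • μ₂) : μ₁ = (0, 1) ∨ μ₂ = (0, 1) := by
  have := eq_of_smul_add_smul_eq_one_zero (μ₁ := μ₁.swap) (μ₂ := μ₂.swap)
    (congrArg Prod.swap h)
  simpa [Prod.swap_eq_iff_eq_swap] using this

theorem w1_mul_w2 : w1 r s * w2 r s = k1 r s := by
  rw [← torus_w1, ← torus_w2, ← torus_k1, ← Units.val_mul, torus_mul]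
  norm_num

theorem k1_mul_w2_eq : k1 r s * w2 r s = k2 r s * k2 r s := by
  simp only [← torus_w2, ← torus_k1, ← torus_k2, ← Units.val_mul, torus_mul]
  norm_num

/-- The torus acts on the nonzero element `e₁` through `r ^ (-b) * s ^ (-(2 a + b))`, which
determines `a` and `b`. -/
theorem torus_injective
    (hrs : ∀ m n : ℤ, r ^ m * s ^ n = 1 → m = 0 ∧ n = 0)
    {a b c d : ℤ} (h : torus r s a b = torus r s c d) : a = c ∧ b = d := by
  have h1 := torus_mul_e1 r s a b
  rw [h, torus_mul_e1] at h1
  have hne : e1 r s * torus r s c d ≠ 0 := by simpa using e1_ne_zero r s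
  have hchi : chi1 r s c d = chi1 r s a b := Units.ext (smul_left_injective ℂ hne h1)
  have : r ^ (d - b) * s ^ (2 * c + d - (2 * a + b)) = 1 := by
    have key (a b : ℤ) : chi1 r s a b = (r ^ b * s ^ (2 * a + b))⁻¹ := by
      rw [chi1, mul_zpow, inv_zpow, inv_zpow, inv_zpow, mul_inv, zpow_add, mul_inv, zpow_mul]
      norm_cast
      exact mul_left_comm ..
    rw [key, key, inv_inj] at hchi
    rw [zpow_sub, zpow_sub, ← div_eq_mul_inv, ← div_eq_mul_inv, div_mul_div_comm, hchi, div_self']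
  have := hrs _ _ this
  omega

theorem mem_hopfAut_apply
    (hrs : ∀ m n : ℤ, r ^ m * s ^ n = 1 → m = 0 ∧ n = 0)
    {θ : V r s ≃ₐ[ℂ] V r s} (hθ : θ ∈ HopfAut ℂ (V r s)) :
    θ (k1 r s) = k1 r s ∧ θ (k2 r s) = k2 r s ∧
      ∃ γ₁ γ₂ : ℂˣ, θ (e1 r s) = (γ₁ : ℂ) • e1 r s ∧ θ (e2 r s) = (γ₂ : ℂ) • e2 r s := by
  obtain ⟨μ₁, h₁⟩ := exists_weight hrs hθ (e1_ne_zero r s) fun a b => ⟨_, torus_mul_e1 r s a b⟩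
  obtain ⟨μ₂, h₂⟩ := exists_weight hrs hθ (e2_ne_zero r s) fun a b => ⟨_, torus_mul_e2 r s a b⟩
  obtain ⟨m, n, hmn⟩ := weight_eq_of_surjective hrs hθ h₁ h₂ (e1_ne_zero r s) conjK1_e1
  obtain ⟨m', n', hmn'⟩ := weight_eq_of_surjective hrs hθ h₁ h₂ (e2_ne_zero r s) conjK1_e2
  have he1 : θ (e1 r s) ≠ 0 := by simpa using e1_ne_zero r s
  have he2 : θ (e2 r s) ≠ 0 := by simpa using e2_ne_zero r s
  have hw1 : IsGroupLikeElem ℂ (θ (w1 r s)) :=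
    isGroupLikeElem_of_mem_hopfAut hθ (torus_w1 r s ▸ isGroupLikeElem_torus r s _ _)
  have hw2 : IsGroupLikeElem ℂ (θ (w2 r s)) :=
    isGroupLikeElem_of_mem_hopfAut hθ (torus_w2 r s ▸ isGroupLikeElem_torus r s _ _)
  have hc1 : Coalgebra.comul (R := ℂ) (θ (e1 r s)) =
      θ (e1 r s) ⊗ₜ[ℂ] 1 + θ (w1 r s) ⊗ₜ[ℂ] θ (e1 r s) := by
    rw [hθ.1, comul_e1]
    simp
  have hc2 : Coalgebra.comul (R := ℂ) (θ (e2 r s)) =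
      θ (e2 r s) ⊗ₜ[ℂ] 1 + θ (w2 r s) ⊗ₜ[ℂ] θ (e2 r s) := by
    rw [hθ.1, comul_e2]
    simp
  have hcases : (μ₁ = (1, 0) ∧ μ₂ = (0, 1)) ∨ (μ₁ = (0, 1) ∧ μ₂ = (1, 0)) := by
    rcases eq_of_smul_add_smul_eq_one_zero hmn with h | h <;>
    rcases eq_of_smul_add_smul_eq_zero_one hmn' with h' | h'
    · simp [h] at h'
    · exact Or.inl ⟨h, h'⟩
    · exact Or.inr ⟨h', h⟩
    · simp [h] at h'
  rcases hcases with ⟨rfl, rfl⟩ | ⟨rfl, rfl⟩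
  · obtain ⟨hw1', c₁, hc₁, hθ1⟩ := skewPrimitive_e1 hrs he1 h₁ hw1 hc1
    obtain ⟨hw2', c₂, hc₂, hθ2⟩ := skewPrimitive_e2 hrs he2 h₂ hw2 hc2
    have hk1 : θ (k1 r s) = k1 r s := by rw [← w1_mul_w2, map_mul, hw1', hw2']
    refine ⟨hk1, ?_, Units.mk0 c₁ hc₁, Units.mk0 c₂ hc₂, hθ1, hθ2⟩
    -- The image of `k₂` is a torus element whose square is `k₂² = k₁ w₂`; comparing exponents
    -- leaves only `k₂`.
    obtain ⟨a, b, hab⟩ := eq_torus_of_isGroupLikeElem hrs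
      (isGroupLikeElem_of_mem_hopfAut hθ (isGroupLikeElem_k2 r s))
    have hsq : θ (k2 r s) * θ (k2 r s) = k2 r s * k2 r s := by
      rw [← map_mul, ← k1_mul_w2_eq, map_mul, hk1, hw2']
    rw [hab, ← torus_k2, ← Units.val_mul, ← Units.val_mul, torus_mul, torus_mul, Units.val_inj]
      at hsq
    have := torus_injective hrs hsq
    obtain ⟨rfl, rfl⟩ : a = 0 ∧ b = 1 := by omega
    rw [hab, torus_k2]
  -- The swapped case: `θ` exchanges `w₁` and `w₂`, so it still fixes their product `k₁`. Then
  -- `θ(e₁)` keeps the weight `(1, 0)` of `e₁`, against the assumed `(0, 1)`.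
  · exfalso
    obtain ⟨hw1', c₁, hc₁, hθ1⟩ := skewPrimitive_e2 hrs he1 h₁ hw1 hc1
    obtain ⟨hw2', -⟩ := skewPrimitive_e1 hrs he2 h₂ hw2 hc2
    have hk1 : θ (k1 r s) = k1 r s := by
      rw [← w1_mul_w2, map_mul, hw1', hw2', w2_mul_w1]
    have h := congrArg θ (conjK1_eq_smul_iff.mp (conjK1_e1 (r := r) (s := s)))
    rw [map_mul, map_smul, map_mul, hk1] at h
    have h' := (conjK1_eq_smul_iff.mpr h).symm.trans h₁
    have := chi_injective hrs (Units.ext (smul_left_injective ℂ he1 h'))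
    simp at this

theorem scaleMonoidHom_surjective
    (hrs : ∀ m n : ℤ, r ^ m * s ^ n = 1 → m = 0 ∧ n = 0) :
    Function.Surjective (scaleMonoidHom r s) := by
  rintro ⟨θ, hθ⟩
  obtain ⟨hk1, hk2, γ₁, γ₂, he1, he2⟩ := mem_hopfAut_apply hrs hθ
  refine ⟨(γ₁, γ₂), Subtype.ext (AlgEquiv.ext fun a => ?_)⟩
  change scaleHom r s γ₁ γ₂ a = (θ : V r s →ₐ[ℂ] V r s) a
  congr 1
  have hinv {k ki : V r s} (h : k * ki = 1) (h' : ki * k = 1) (hk : θ k = k) : θ ki = ki := by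
    have h1 : k * θ ki = 1 := by
      have := congrArg θ h
      rwa [map_mul, hk, map_one] at this
    exact (left_inv_eq_right_inv h' h1).symm
  refine algHom_ext fun x => ?_
  rw [scaleHom_gen]
  cases x
  · exact he1.symm
  · exact he2.symm
  · exact hk1.symm
  · exact (hinv (k1_mul_k1inv r s) (k1inv_mul_k1 r s) hk1).symm
  · exact hk2.symm
  · exact (hinv (k2_mul_k2inv r s) (k2inv_mul_k2 r s) hk2).symm

end Automorphisms
end TwoParamB2

open TwoParamB2 in
theorem mainTheorem3 (r s : ℂˣ)
    (hrs : ∀ m n : ℤ, r ^ m * s ^ n = 1 → m = 0 ∧ n = 0) :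
    (∀ θ ∈ HopfAut ℂ (V r s),
      θ (k1 r s) = k1 r s ∧ θ (k2 r s) = k2 r s ∧
        ∃ γ₁ γ₂ : ℂˣ, θ (e1 r s) = (γ₁ : ℂ) • e1 r s ∧ θ (e2 r s) = (γ₂ : ℂ) • e2 r s) ∧
    ∃ Φ : HopfAut ℂ (V r s) ≃* ℂˣ × ℂˣ, ∀ θ : HopfAut ℂ (V r s),
      (θ : V r s ≃ₐ[ℂ] V r s) (e1 r s) = ((Φ θ).1 : ℂ) • e1 r s ∧
        (θ : V r s ≃ₐ[ℂ] V r s) (e2 r s) = ((Φ θ).2 : ℂ) • e2 r s := by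
  refine ⟨fun θ hθ => mem_hopfAut_apply hrs hθ, ?_⟩
  let Ψ := MulEquiv.ofBijective (scaleMonoidHom r s)
    ⟨scaleMonoidHom_injective r s, scaleMonoidHom_surjective hrs⟩
  refine ⟨Ψ.symm, fun θ => ?_⟩
  obtain ⟨γ, rfl⟩ := Ψ.surjective θ
  rw [MulEquiv.symm_apply_apply]
  exact ⟨scaleHom_e1 .., scaleHom_e2 ..⟩
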